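/- All vector spaces are over $\mathbb{C}$. Let $\mathfrak{g}=\mathfrak{g}_{\bar 0}\oplus\mathfrak{g}_{\bar 1}$ be a finite-dimensional simple Lie superalgebra (non-abelian, with no $\mathbb{Z}_2$-graded ideals other than $0$ and $\mathfrak{g}$), let $A$ be a finitely generated commutative associative unital algebra, and let $\Gamma$ be a finite abelian group acting by automorphisms on $\mathfrak{g}$ (even Lie superalgebra automorphisms) and on $A$ (algebra automorphisms), such that the induced action of $\Gamma$ on the set $\operatorname{MaxSpec}(A)$ of maximal ideals of $A$ is free. Let $(\mathfrak{g}\otimes A)^\Gamma$ be the Lie superalgebra of fixed points of the diagonal action of $\Gamma$ on $\mathfrak{g}\otimes A$, where $\mathfrak{g}\otimes A$ has the bracket $[x\otimes a,y\otimes b]=[x,y]\otimes ab$ and the grading $(\mathfrak{g}\otimes A)_z=\mathfrak{g}_z\otimes A$. Modules are $\mathbb{Z}_2$-graded. A module is irreducible if it is nonzero and has no graded submodules other than $0$ and itself, and it is trivial if the Lie superalgebra acts on it by $0$. For a $(\mathfrak{g}\otimes A)^\Gamma$-module $V$, let $\operatorname{Ann}_A(V)$ be the sum of all $\Gamma$-invariant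 ideals $I$ of $A$ such that $(\mathfrak{g}\otimes I)^\Gamma V=0$, where $(\mathfrak{g}\otimes I)^\Gamma=(\mathfrak{g}\otimes I)\cap(\mathfrak{g}\otimes A)^\Gamma$. The support of $V$ is the set of all $\mathsf{m}\in\operatorname{MaxSpec}(A)$ that contain $\operatorname{Ann}_A(V)$. For modules $V,U$ over a Lie superalgebra $L$, let $L$ act on $\operatorname{Hom}_{\mathbb{C}}(V,U)$ by $x\cdot\varphi=x\circ\varphi-(-1)^{|x||\varphi|}\varphi\circ x$ for homogeneous $x,\varphi$. Then $\operatorname{Ext}^1_L(V,U)$ is the first Chevalley--Eilenberg cohomology of $L$ with coefficients in $\operatorname{Hom}_{\mathbb{C}}(V,U)$, that is, the quotient of the space of all linear maps $f\colon L\to\operatorname{Hom}_{\mathbb{C}}(V,U)$ (even, odd, and sums of these) satisfying $f([x,y])=x\cdot f(y)-(-1)^{|x||y|}\,y\cdot f(x)$ for all homogeneous $x,y\in L$, by the subspace of the maps $x\mapsto x\cdot\varphi$ with $\varphi\in\operatorname{Hom}_{\mathbb{C}}(V,U)$. Let $V$ and $V'$ be nontrivial, finite-dimensional, irreducible $(\mathfrak{g}\otimes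 A)^\Gamma$-modules. If the supports of $V$ and $V'$ are disjoint, then $$\operatorname{Ext}^1_{(\mathfrak{g}\otimes A)^\Gamma}(V,V')=0.$$ -/

import Mathlib

open scoped TensorProduct Pointwise

/-! ### Super spaces -/

/-- A complex super space: a vector space with a `ℤ/2`-grading `V = V₀ ⊕ V₁`. -/
class SuperSpace (V : Type*) [AddCommGroup V] [Module ℂ V] where
  gr : ZMod 2 → Submodule ℂ V
  isCompl : IsCompl (gr 0) (gr 1)

/-- The sign `(-1)^{|x||y|}` for homogeneous `x`, `y` of degrees `i`, `j`. -/
def superSign (i j : ZMod 2) : ℂ := (-1) ^ (i.val * j.val)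

theorem zmod2_cases (i : ZMod 2) : i = 0 ∨ i = 1 := by
  revert i; decide

@[simp] theorem superSign_zero_left (j : ZMod 2) : superSign 0 j = 1 := by simp [superSign]

@[simp] theorem superSign_zero_right (j : ZMod 2) : superSign j 0 = 1 := by simp [superSign]

@[simp] theorem superSign_one_one : superSign 1 1 = -1 := by
  simp [superSign, ZMod.val_one]

namespace SuperSpace

section
variable {V : Type*} [AddCommGroup V] [Module ℂ V]

theorem isCompl_of_maps {S T : Submodule ℂ V} (p q : V →ₗ[ℂ] V)
    (hpq : ∀ x, p x + q x = x) (hp : ∀ x, p x ∈ S) (hq : ∀ x, q x ∈ T)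
    (hpT : ∀ x ∈ T, p x = 0) (hqS : ∀ x ∈ S, q x = 0) : IsCompl S T := by
  constructor
  · rw [Submodule.disjoint_def]
    intro x hS hT
    rw [← hpq x, hpT x hT, hqS x hS, add_zero]
  · rw [codisjoint_iff, eq_top_iff]
    intro x _
    rw [← hpq x]
    exact Submodule.add_mem_sup (hp x) (hq x)

variable [SuperSpace V]

/-- The projection of a super space onto its even part. -/
noncomputable def evenProj (V : Type*) [AddCommGroup V] [Module ℂ V] [SuperSpace V] :
    V →ₗ[ℂ] V := (gr (V := V) 0).projection (gr 1) isCompl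

/-- The projection of a super space onto its odd part. -/
noncomputable def oddProj (V : Type*) [AddCommGroup V] [Module ℂ V] [SuperSpace V] :
    V →ₗ[ℂ] V := (gr (V := V) 1).projection (gr 0) isCompl.symm

/-- The parity involution `v ↦ (-1)^{|v|} v` of a super space. -/
noncomputable def parity (V : Type*) [AddCommGroup V] [Module ℂ V] [SuperSpace V] :
    V →ₗ[ℂ] V := evenProj V - oddProj V

theorem evenProj_mem (x : V) : evenProj V x ∈ gr (V := V) 0 :=
  Submodule.projection_apply_mem _ _

theorem oddProj_mem (x : V) : oddProj V x ∈ gr (V := V) 1 :=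
  Submodule.projection_apply_mem _ _

theorem evenProj_add_oddProj (x : V) : evenProj V x + oddProj V x = x :=
  Submodule.projection_add_projection_eq_self _ x

theorem evenProj_of_even {x : V} (hx : x ∈ gr (V := V) 0) : evenProj V x = x :=
  Submodule.projection_apply_of_mem_left _ hx

theorem oddProj_of_odd {x : V} (hx : x ∈ gr (V := V) 1) : oddProj V x = x :=
  Submodule.projection_apply_of_mem_left _ hx

theorem evenProj_of_odd {x : V} (hx : x ∈ gr (V := V) 1) : evenProj V x = 0 :=
  (Submodule.projection_apply_eq_zero_iff _).2 hx

theorem oddProj_of_even {x : V} (hx : x ∈ gr (V := V) 0) : oddProj V x = 0 :=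
  (Submodule.projection_apply_eq_zero_iff _).2 hx

theorem parity_of_mem {i : ZMod 2} {x : V} (hx : x ∈ gr (V := V) i) :
    parity V x = superSign 1 i • x := by
  rcases zmod2_cases i with rfl | rfl
  · simp [parity, evenProj_of_even hx, oddProj_of_even hx]
  · simp [parity, evenProj_of_odd hx, oddProj_of_odd hx]

theorem parity_parity (x : V) : parity V (parity V x) = x := by
  have h : parity V x = evenProj V x - oddProj V x := rfl
  rw [h, map_sub, parity_of_mem (evenProj_mem x), parity_of_mem (oddProj_mem x)]
  simp [evenProj_add_oddProj]

theorem hom_ext {W : Type*} [AddCommGroup W] [Module ℂ W] {f g : V →ₗ[ℂ] W}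
    (h : ∀ i, ∀ x ∈ gr (V := V) i, f x = g x) : f = g := by
  ext x
  rw [← evenProj_add_oddProj x, map_add, map_add, h 0 _ (evenProj_mem x), h 1 _ (oddProj_mem x)]

end

/-- The grading of `Hom(V, U)`: `φ` has degree `z` if it maps `V_i` to `U_{i+z}` for all `i`. -/
noncomputable instance instHom {V U : Type*} [AddCommGroup V] [Module ℂ V] [SuperSpace V]
    [AddCommGroup U] [Module ℂ U] [SuperSpace U] : SuperSpace (V →ₗ[ℂ] U) where
  gr z :=
    { carrier := {φ | ∀ i, ∀ v ∈ gr (V := V) i, φ v ∈ gr (V := U) (i + z)}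
      zero_mem' := fun _ _ _ => Submodule.zero_mem _
      add_mem' := fun ha hb i v hv => Submodule.add_mem _ (ha i v hv) (hb i v hv)
      smul_mem' := fun c _ ha i v hv => Submodule.smul_mem _ c (ha i v hv) }
  isCompl := by
    refine isCompl_of_maps
      ((evenProj V).lcomp ℂ U ∘ₗ (evenProj U).compRight ℂ
        + (oddProj V).lcomp ℂ U ∘ₗ (oddProj U).compRight ℂ)
      ((evenProj V).lcomp ℂ U ∘ₗ (oddProj U).compRight ℂ
        + (oddProj V).lcomp ℂ U ∘ₗ (evenProj U).compRight ℂ) ?_ ?_ ?_ ?_ ?_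
    · intro φ
      ext v
      have h : φ v = φ (evenProj V v) + φ (oddProj V v) := by
        rw [← map_add, evenProj_add_oddProj]
      rw [h, ← evenProj_add_oddProj (φ (evenProj V v)), ← evenProj_add_oddProj (φ (oddProj V v))]
      simp [evenProj_add_oddProj]
      rw [← evenProj_add_oddProj (φ (evenProj V v)), ← evenProj_add_oddProj (φ (oddProj V v))]
      simp only [map_add, evenProj_of_even (evenProj_mem _), oddProj_of_odd (oddProj_mem _),
        evenProj_of_odd (oddProj_mem _), oddProj_of_even (evenProj_mem _)]
      abel
    · intro φ i v hv
      rcases zmod2_cases i with rfl | rfl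
      · simpa [evenProj_of_even hv, oddProj_of_even hv] using evenProj_mem _
      · simpa [evenProj_of_odd hv, oddProj_of_odd hv] using oddProj_mem _
    · intro φ i v hv
      rcases zmod2_cases i with rfl | rfl
      · simpa [evenProj_of_even hv, oddProj_of_even hv] using oddProj_mem _
      · simpa [evenProj_of_odd hv, oddProj_of_odd hv, show (1 + 1 : ZMod 2) = 0 from rfl]
          using evenProj_mem _
    · intro φ hφ
      refine hom_ext fun i v hv => ?_
      rcases zmod2_cases i with rfl | rfl
      · simpa [evenProj_of_even hv, oddProj_of_even hv] using evenProj_of_odd (hφ 0 v hv)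
      · simpa [evenProj_of_odd hv, oddProj_of_odd hv] using oddProj_of_even (hφ 1 v hv)
    · intro φ hφ
      refine hom_ext fun i v hv => ?_
      rcases zmod2_cases i with rfl | rfl
      · simpa [evenProj_of_even hv, oddProj_of_even hv] using oddProj_of_even (hφ 0 v hv)
      · simpa [evenProj_of_odd hv, oddProj_of_odd hv] using evenProj_of_odd (hφ 1 v hv)

/-- A subspace of a super space is graded if it contains the homogeneous components of each of
its elements. -/
def IsGraded {V : Type*} [AddCommGroup V] [Module ℂ V] [SuperSpace V]
    (W : Submodule ℂ V) : Prop :=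
  ∀ w ∈ W, evenProj V w ∈ W ∧ oddProj V w ∈ W

end SuperSpace

open SuperSpace

/-! ### Lie superalgebras and their modules -/

/-- A complex Lie superalgebra. -/
class LieSuperalgebra (L : Type*) [AddCommGroup L] [Module ℂ L] extends SuperSpace L where
  bracket : L →ₗ[ℂ] L →ₗ[ℂ] L
  bracket_mem : ∀ i j, ∀ x ∈ gr i, ∀ y ∈ gr j, bracket x y ∈ gr (i + j)
  bracket_skew : ∀ i j, ∀ x ∈ gr i, ∀ y ∈ gr j, bracket x y = -(superSign i j • bracket y x)
  jacobi : ∀ i j k, ∀ x ∈ gr i, ∀ y ∈ gr j, ∀ z ∈ gr k,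
    bracket x (bracket y z) = bracket (bracket x y) z + superSign i j • bracket y (bracket x z)

/-- A module `V` over a Lie superalgebra `L`: a homomorphism of Lie superalgebras
`L → gl(V)` for the super space `V`. -/
class LieSupermodule (L : Type*) [AddCommGroup L] [Module ℂ L] [LieSuperalgebra L]
    (V : Type*) [AddCommGroup V] [Module ℂ V] [SuperSpace V] where
  act : L →ₗ[ℂ] V →ₗ[ℂ] V
  act_mem : ∀ i j, ∀ x ∈ gr (V := L) i, ∀ v ∈ gr (V := V) j, act x v ∈ gr (V := V) (i + j)
  act_bracket : ∀ i j, ∀ x ∈ gr (V := L) i, ∀ y ∈ gr (V := L) j, ∀ v : V,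
    act (LieSuperalgebra.bracket x y) v = act x (act y v) - superSign i j • act y (act x v)

namespace LieSuperalgebra

/-- A Lie superalgebra is simple if it is not abelian and has no graded ideals besides `0` and
itself. -/
def IsSimple (L : Type*) [AddCommGroup L] [Module ℂ L] [LieSuperalgebra L] : Prop :=
  (∃ x y : L, bracket x y ≠ 0) ∧
    ∀ I : Submodule ℂ L, IsGraded I → (∀ x : L, ∀ y ∈ I, bracket x y ∈ I) → I = ⊥ ∨ I = ⊤

/-- The group `Γ` acts on the Lie superalgebra `L` by (even, linear) automorphisms. -/
class ActsByAut (Γ : Type*) [Group Γ] (L : Type*) [AddCommGroup L] [Module ℂ L]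
    [LieSuperalgebra L] [DistribMulAction Γ L] : Prop extends SMulCommClass Γ ℂ L where
  smul_mem : ∀ (γ : Γ) (i : ZMod 2), ∀ x ∈ gr (V := L) i, γ • x ∈ gr (V := L) i
  smul_bracket : ∀ (γ : Γ) (x y : L), γ • bracket x y = bracket (γ • x) (γ • y)

end LieSuperalgebra

namespace LieSupermodule

section
variable (L : Type*) [AddCommGroup L] [Module ℂ L] [LieSuperalgebra L]

/-- An `L`-module is irreducible if it is nonzero and has no graded submodules besides `0` and
itself. -/
def IsIrreducible (V : Type*) [AddCommGroup V] [Module ℂ V] [SuperSpace V]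
    [LieSupermodule L V] : Prop :=
  Nontrivial V ∧ ∀ W : Submodule ℂ V, IsGraded W → (∀ x : L, ∀ w ∈ W, act x w ∈ W) →
    W = ⊥ ∨ W = ⊤

/-- An `L`-module `V` is trivial if `L · V = 0`. -/
def IsTrivial (V : Type*) [AddCommGroup V] [Module ℂ V] [SuperSpace V]
    [LieSupermodule L V] : Prop :=
  ∀ (x : L) (v : V), act x v = 0

end

section Hom
variable {L : Type*} [AddCommGroup L] [Module ℂ L] [LieSuperalgebra L]
  {V : Type*} [AddCommGroup V] [Module ℂ V] [SuperSpace V] [LieSupermodule L V]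
  {U : Type*} [AddCommGroup U] [Module ℂ U] [SuperSpace U] [LieSupermodule L U]

theorem act_parity {i : ZMod 2} {x : L} (hx : x ∈ gr (V := L) i) (v : V) :
    act x (parity V v) = superSign 1 i • parity V (act x v) := by
  have : act (V := V) x ∘ₗ parity V = superSign 1 i • (parity V ∘ₗ act x) := by
    refine hom_ext fun j v hv => ?_
    have h := act_mem i j x hx v hv
    simp only [LinearMap.comp_apply, LinearMap.smul_apply, parity_of_mem hv, parity_of_mem h,
      map_smul, smul_smul]
    rcases zmod2_cases i with rfl | rfl <;> rcases zmod2_cases j with rfl | rfl <;>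
      simp [show (1 + 1 : ZMod 2) = 0 from rfl]
  exact LinearMap.congr_fun this v

/-- The action of `L` on `Hom(V, U)`; for homogeneous `x` and `φ` it is
`x · φ = x ∘ φ - (-1)^{|x||φ|} φ ∘ x`, see `homAct_of_mem`.  For odd `x`, the sign is
produced by conjugating `φ` by the parity involutions. -/
noncomputable def homAct : L →ₗ[ℂ] (V →ₗ[ℂ] U) →ₗ[ℂ] (V →ₗ[ℂ] U) :=
  LinearMap.mk₂ ℂ
    (fun x φ => act x ∘ₗ φ - φ ∘ₗ act (evenProj L x)
      - parity U ∘ₗ φ ∘ₗ parity V ∘ₗ act (oddProj L x))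
    (by intro x y φ; ext v; simp; abel)
    (by intro c x φ; ext v; simp [smul_sub])
    (by intro x φ ψ; ext v; simp; abel)
    (by intro c x φ; ext v; simp [smul_sub])

theorem homAct_apply (x : L) (φ : V →ₗ[ℂ] U) (v : V) :
    homAct x φ v = act x (φ v) - φ (act (evenProj L x) v)
      - parity U (φ (parity V (act (oddProj L x) v))) := rfl

theorem homAct_even {x : L} (hx : x ∈ gr (V := L) 0) (φ : V →ₗ[ℂ] U) (v : V) :
    homAct x φ v = act x (φ v) - φ (act x v) := by
  simp [homAct_apply, evenProj_of_even hx, oddProj_of_even hx]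

theorem homAct_odd {x : L} (hx : x ∈ gr (V := L) 1) (φ : V →ₗ[ℂ] U) (v : V) :
    homAct x φ v = act x (φ v) - parity U (φ (parity V (act x v))) := by
  simp [homAct_apply, evenProj_of_odd hx, oddProj_of_odd hx]

theorem homAct_of_mem {i j : ZMod 2} {x : L} (hx : x ∈ gr (V := L) i) {φ : V →ₗ[ℂ] U}
    (hφ : φ ∈ gr (V := V →ₗ[ℂ] U) j) :
    homAct x φ = act x ∘ₗ φ - superSign i j • (φ ∘ₗ act x) := by
  refine hom_ext fun k v hv => ?_
  rcases zmod2_cases i with rfl | rfl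
  · simp [homAct_even hx]
  · have h1 := act_mem 1 k x hx v hv
    have h2 := hφ _ _ h1
    rw [homAct_odd hx, parity_of_mem h1, map_smul, map_smul, parity_of_mem h2]
    rcases zmod2_cases k with rfl | rfl <;> rcases zmod2_cases j with rfl | rfl <;>
      simp [show (1 + 1 : ZMod 2) = 0 from rfl]

/-- The `L`-module `Hom(V, U)`. -/
noncomputable instance instHom : LieSupermodule L (V →ₗ[ℂ] U) where
  act := homAct
  act_mem i j x hx φ hφ := by
    rw [homAct_of_mem hx hφ]
    intro k v hv
    refine Submodule.sub_mem _ ?_ (Submodule.smul_mem _ _ ?_)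
    · have := act_mem i _ x hx _ (hφ k v hv)
      rwa [show i + (k + j) = k + (i + j) by abel] at this
    · have := hφ _ _ (act_mem i k x hx v hv)
      rwa [show i + k + j = k + (i + j) by abel] at this
  act_bracket i j x hx y hy φ := by
    have hxy := LieSuperalgebra.bracket_mem i j x hx y hy
    ext v
    rcases zmod2_cases i with rfl | rfl <;> rcases zmod2_cases j with rfl | rfl
    · rw [zero_add] at hxy
      simp only [LinearMap.sub_apply, homAct_even hxy, homAct_even hx,
        homAct_even hy, act_bracket _ _ x hx y hy, map_sub, superSign_zero_left, one_smul]
      abel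
    · rw [zero_add] at hxy
      simp only [LinearMap.sub_apply, homAct_odd hxy, homAct_even hx,
        homAct_odd hy, act_bracket _ _ x hx y hy, map_sub, superSign_zero_left, one_smul]
      simp only [act_parity hx, superSign_zero_right, one_smul]
      abel
    · rw [add_zero] at hxy
      simp only [LinearMap.sub_apply, homAct_odd hxy, homAct_odd hx,
        homAct_even hy, act_bracket _ _ x hx y hy, map_sub, superSign_zero_right, one_smul]
      simp only [act_parity hy, superSign_zero_right, one_smul]
      abel
    · rw [show (1 + 1 : ZMod 2) = 0 from rfl] at hxy
      simp only [LinearMap.sub_apply, LinearMap.smul_apply, homAct_even hxy, homAct_odd hx,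
        homAct_odd hy, act_bracket _ _ x hx y hy, map_sub, map_smul, superSign_one_one]
      simp only [act_parity hx, act_parity hy, superSign_one_one, parity_parity,
        neg_smul, one_smul, map_neg]
      abel

end Hom

/-! ### First cohomology and first extensions -/

section Cohomology
variable (L : Type*) [AddCommGroup L] [Module ℂ L] [LieSuperalgebra L]
  (M : Type*) [AddCommGroup M] [Module ℂ M] [SuperSpace M] [LieSupermodule L M]

/-- The 1-cocycles (kernel of `d¹`) of the Chevalley-Eilenberg complex of `L` with coefficients in
`M`, that is, the linear maps `f : L → M` with
`f [x, y] = x · f y - (-1)^{|x||y|} y · f x` for homogeneous `x`, `y`.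
Both even and odd `f` (and their sums) are included. -/
def cocycles₁ : Submodule ℂ (L →ₗ[ℂ] M) where
  carrier := {f | ∀ i j, ∀ x ∈ gr (V := L) i, ∀ y ∈ gr (V := L) j,
    f (LieSuperalgebra.bracket x y) = act x (f y) - superSign i j • act y (f x)}
  zero_mem' := by intro i j x _ y _; simp
  add_mem' := by
    intro f g hf hg i j x hx y hy
    simp only [LinearMap.add_apply, hf i j x hx y hy, hg i j x hx y hy, map_add, smul_add]
    abel
  smul_mem' := by
    intro c f hf i j x hx y hy
    simp only [LinearMap.smul_apply, hf i j x hx y hy, map_smul, smul_sub, smul_comm c]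

/-- The 1-coboundaries (image of `d⁰`): the maps `x ↦ x · m`, for `m` in `M`. -/
def coboundaries₁ : Submodule ℂ (L →ₗ[ℂ] M) :=
  LinearMap.range (act (L := L) (V := M)).flip

theorem coboundaries₁_le_cocycles₁ : coboundaries₁ L M ≤ cocycles₁ L M := by
  rintro _ ⟨m, rfl⟩ i j x hx y hy
  exact act_bracket i j x hx y hy m

/-- The first cohomology `H¹(L, M)`. -/
abbrev H₁ : Type _ := cocycles₁ L M ⧸ (coboundaries₁ L M).submoduleOf (cocycles₁ L M)

/-- `Ext¹_L(V, U)`: the cohomology in degree one of the complex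
`Hom(V, U) → Hom(L ⊗ V, U) → Hom(Λ²L ⊗ V, U) → ⋯`, that is, of the Chevalley-Eilenberg complex
of `L` with coefficients in `Hom(V, U)`. -/
abbrev Ext₁ (V : Type*) [AddCommGroup V] [Module ℂ V] [SuperSpace V] [LieSupermodule L V]
    (U : Type*) [AddCommGroup U] [Module ℂ U] [SuperSpace U] [LieSupermodule L U] : Type _ :=
  H₁ L (V →ₗ[ℂ] U)

end Cohomology

end LieSupermodule

/-! ### Map superalgebras -/

section MapSuperalgebra

variable {𝔤 : Type*} [AddCommGroup 𝔤] [Module ℂ 𝔤] [LieSuperalgebra 𝔤]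
  {A : Type*} [CommRing A] [Algebra ℂ A]

namespace MapSuperalgebra

/-- The subspace `𝔤_z ⊗ A` of `𝔤 ⊗ A`. -/
def grade (𝔤 : Type*) [AddCommGroup 𝔤] [Module ℂ 𝔤] [LieSuperalgebra 𝔤]
    (A : Type*) [CommRing A] [Algebra ℂ A] (z : ZMod 2) : Submodule ℂ (𝔤 ⊗[ℂ] A) :=
  Submodule.span ℂ {t | ∃ x ∈ gr (V := 𝔤) z, ∃ a : A, t = x ⊗ₜ[ℂ] a}

/-- The bracket `[x ⊗ a, y ⊗ b] = [x, y] ⊗ ab` of `𝔤 ⊗ A`. -/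
noncomputable def bracket (𝔤 : Type*) [AddCommGroup 𝔤] [Module ℂ 𝔤] [LieSuperalgebra 𝔤]
    (A : Type*) [CommRing A] [Algebra ℂ A] : 𝔤 ⊗[ℂ] A →ₗ[ℂ] 𝔤 ⊗[ℂ] A →ₗ[ℂ] 𝔤 ⊗[ℂ] A :=
  TensorProduct.map₂ LieSuperalgebra.bracket (LinearMap.mul ℂ A)

@[simp] theorem bracket_tmul (x y : 𝔤) (a b : A) :
    bracket 𝔤 A (x ⊗ₜ a) (y ⊗ₜ b) = LieSuperalgebra.bracket x y ⊗ₜ (a * b) := by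
  simp [bracket, TensorProduct.map₂]

theorem isCompl_grade : IsCompl (grade 𝔤 A 0) (grade 𝔤 A 1) := by
  have key : ∀ (z : ZMod 2) (p : 𝔤 →ₗ[ℂ] 𝔤), (∀ x ∈ gr (V := 𝔤) z, p x = 0) →
      ∀ t ∈ grade 𝔤 A z, p.rTensor A t = 0 := by
    intro z p hp t ht
    induction ht using Submodule.span_induction with
    | mem t ht => obtain ⟨x, hx, a, rfl⟩ := ht; simp [hp x hx]
    | zero => simp
    | add s t _ _ hs ht => simp [hs, ht]
    | smul c t _ ht => simp [ht]
  have key' : ∀ (z : ZMod 2) (p : 𝔤 →ₗ[ℂ] 𝔤), (∀ x, p x ∈ gr (V := 𝔤) z) →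
      ∀ t : 𝔤 ⊗[ℂ] A, p.rTensor A t ∈ grade 𝔤 A z := by
    intro z p hp t
    induction t using TensorProduct.induction_on with
    | zero => simp
    | tmul x a => exact Submodule.subset_span ⟨p x, hp x, a, by simp⟩
    | add s t hs ht => rw [map_add]; exact Submodule.add_mem _ hs ht
  refine isCompl_of_maps ((evenProj 𝔤).rTensor A) ((oddProj 𝔤).rTensor A) ?_
    (key' 0 _ evenProj_mem) (key' 1 _ oddProj_mem)
    (key 1 _ fun x hx => evenProj_of_odd hx) (key 0 _ fun x hx => oddProj_of_even hx)
  intro t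
  rw [← LinearMap.add_apply, ← LinearMap.rTensor_add,
    show evenProj 𝔤 + oddProj 𝔤 = LinearMap.id from LinearMap.ext evenProj_add_oddProj,
    LinearMap.rTensor_id, LinearMap.id_apply]

/-- The map superalgebra `𝔤 ⊗ A`. -/
noncomputable instance instLieSuperalgebra : LieSuperalgebra (𝔤 ⊗[ℂ] A) where
  gr := grade 𝔤 A
  isCompl := isCompl_grade
  bracket := bracket 𝔤 A
  bracket_mem i j s hs t ht := by
    induction hs, ht using Submodule.span_induction₂ with
    | mem_mem s t hs ht =>
      obtain ⟨x, hx, a, rfl⟩ := hs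
      obtain ⟨y, hy, b, rfl⟩ := ht
      rw [bracket_tmul]
      exact Submodule.subset_span ⟨_, LieSuperalgebra.bracket_mem i j x hx y hy, _, rfl⟩
    | zero_left t _ => simp
    | zero_right s _ => simp
    | add_left s s' t _ _ _ h h' => simpa using Submodule.add_mem _ h h'
    | add_right s t t' _ _ _ h h' => simpa using Submodule.add_mem _ h h'
    | smul_left c s t _ _ h => simpa using Submodule.smul_mem _ c h
    | smul_right c s t _ _ h => simpa using Submodule.smul_mem _ c h
  bracket_skew i j s hs t ht := by
    induction hs, ht using Submodule.span_induction₂ with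
    | mem_mem s t hs ht =>
      obtain ⟨x, hx, a, rfl⟩ := hs
      obtain ⟨y, hy, b, rfl⟩ := ht
      rw [bracket_tmul, bracket_tmul, LieSuperalgebra.bracket_skew i j x hx y hy, mul_comm a b,
        TensorProduct.neg_tmul, TensorProduct.smul_tmul']
    | zero_left t _ => simp
    | zero_right s _ => simp
    | add_left s s' t _ _ _ h h' => simp only [map_add, LinearMap.add_apply, h, h', smul_add]; abel
    | add_right s t t' _ _ _ h h' => simp only [map_add, LinearMap.add_apply, h, h', smul_add]; abel
    | smul_left c s t _ _ h =>
      simp only [map_smul, LinearMap.smul_apply, h, smul_neg, smul_comm c]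
    | smul_right c s t _ _ h =>
      simp only [map_smul, LinearMap.smul_apply, h, smul_neg, smul_comm c]
  jacobi i j k s hs t ht u hu := by
    induction hs using Submodule.span_induction with
    | zero => simp
    | add s s' _ _ h h' => simp only [map_add, LinearMap.add_apply, h, h', smul_add]; abel
    | smul c s _ h => simp only [map_smul, LinearMap.smul_apply, h, smul_add, smul_comm c]
    | mem s hs =>
      obtain ⟨x, hx, a, rfl⟩ := hs
      induction ht, hu using Submodule.span_induction₂ with
      | mem_mem t u ht hu =>
        obtain ⟨y, hy, b, rfl⟩ := ht
        obtain ⟨z, hz, c, rfl⟩ := hu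
        simp only [bracket_tmul]
        rw [LieSuperalgebra.jacobi i j k x hx y hy z hz, TensorProduct.add_tmul,
          TensorProduct.smul_tmul', mul_assoc, mul_left_comm b a c]
      | zero_left t _ => simp
      | zero_right s _ => simp
      | add_left s s' t _ _ _ h h' =>
        simp only [map_add, LinearMap.add_apply, h, h', smul_add]; abel
      | add_right s t t' _ _ _ h h' =>
        simp only [map_add, h, h', smul_add]; abel
      | smul_left c s t _ _ h =>
        simp only [map_smul, LinearMap.smul_apply, h, smul_add, smul_comm c]
      | smul_right c s t _ _ h =>
        simp only [map_smul, h, smul_add, smul_comm c]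

/-- The subspace `𝔤 ⊗ I` of `𝔤 ⊗ A`, for an ideal `I` of `A`. -/
def ofIdeal (𝔤 : Type*) [AddCommGroup 𝔤] [Module ℂ 𝔤] [LieSuperalgebra 𝔤]
    {A : Type*} [CommRing A] [Algebra ℂ A] (I : Ideal A) : Submodule ℂ (𝔤 ⊗[ℂ] A) :=
  Submodule.span ℂ {t | ∃ x : 𝔤, ∃ a ∈ I, t = x ⊗ₜ[ℂ] a}

end MapSuperalgebra

/-! ### Equivariant map superalgebras -/

namespace EquivariantMap

open LieSuperalgebra

variable (Γ : Type*) [Group Γ] (𝔤 : Type*) [AddCommGroup 𝔤] [Module ℂ 𝔤] [LieSuperalgebra 𝔤]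
  [DistribMulAction Γ 𝔤] [ActsByAut Γ 𝔤]
  (A : Type*) [CommRing A] [Algebra ℂ A] [MulSemiringAction Γ A] [SMulCommClass Γ ℂ A]

/-- The diagonal action `γ (x ⊗ a) = γ x ⊗ γ a` of `Γ` on `𝔤 ⊗ A`. -/
noncomputable def diag (γ : Γ) : 𝔤 ⊗[ℂ] A →ₗ[ℂ] 𝔤 ⊗[ℂ] A :=
  TensorProduct.map (DistribSMul.toLinearMap ℂ 𝔤 γ) (DistribSMul.toLinearMap ℂ A γ)

/-- The subspace of `Γ`-fixed points of `𝔤 ⊗ A`. -/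
noncomputable def fixed : Submodule ℂ (𝔤 ⊗[ℂ] A) where
  carrier := {t | ∀ γ : Γ, diag Γ 𝔤 A γ t = t}
  zero_mem' := fun _ => map_zero _
  add_mem' := fun hs ht γ => by rw [map_add, hs γ, ht γ]
  smul_mem' := fun c _ ht γ => by rw [map_smul, ht γ]

variable {Γ 𝔤 A}

@[simp] theorem diag_tmul (γ : Γ) (x : 𝔤) (a : A) :
    diag Γ 𝔤 A γ (x ⊗ₜ a) = (γ • x) ⊗ₜ (γ • a) := rfl

theorem diag_bracket (γ : Γ) (s t : 𝔤 ⊗[ℂ] A) :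
    diag Γ 𝔤 A γ (bracket s t) = bracket (diag Γ 𝔤 A γ s) (diag Γ 𝔤 A γ t) := by
  induction s using TensorProduct.induction_on with
  | zero => simp
  | add s s' h h' => simp only [map_add, LinearMap.add_apply, h, h']
  | tmul x a =>
    induction t using TensorProduct.induction_on with
    | zero => simp
    | add s s' h h' => simp only [map_add, h, h']
    | tmul y b =>
      change diag Γ 𝔤 A γ (MapSuperalgebra.bracket 𝔤 A _ _) = MapSuperalgebra.bracket 𝔤 A _ _
      simp only [MapSuperalgebra.bracket_tmul, diag_tmul, ActsByAut.smul_bracket, smul_mul']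

theorem diag_mem (γ : Γ) (z : ZMod 2) {t : 𝔤 ⊗[ℂ] A} (ht : t ∈ gr (V := 𝔤 ⊗[ℂ] A) z) :
    diag Γ 𝔤 A γ t ∈ gr (V := 𝔤 ⊗[ℂ] A) z := by
  change t ∈ MapSuperalgebra.grade 𝔤 A z at ht
  change _ ∈ MapSuperalgebra.grade 𝔤 A z
  induction ht using Submodule.span_induction with
  | mem t ht =>
    obtain ⟨x, hx, a, rfl⟩ := ht
    exact Submodule.subset_span ⟨_, ActsByAut.smul_mem γ z x hx, _, rfl⟩
  | zero => simp
  | add s t _ _ hs ht => rw [map_add]; exact Submodule.add_mem _ hs ht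
  | smul c t _ ht => rw [map_smul]; exact Submodule.smul_mem _ c ht

theorem diag_evenProj (γ : Γ) (t : 𝔤 ⊗[ℂ] A) :
    diag Γ 𝔤 A γ (evenProj _ t) = evenProj _ (diag Γ 𝔤 A γ t) := by
  conv_rhs => rw [← evenProj_add_oddProj t]
  rw [map_add, map_add, evenProj_of_even (diag_mem γ 0 (evenProj_mem t)),
    evenProj_of_odd (diag_mem γ 1 (oddProj_mem t)), add_zero]

theorem diag_oddProj (γ : Γ) (t : 𝔤 ⊗[ℂ] A) :
    diag Γ 𝔤 A γ (oddProj _ t) = oddProj _ (diag Γ 𝔤 A γ t) := by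
  conv_rhs => rw [← evenProj_add_oddProj t]
  rw [map_add, map_add, oddProj_of_even (diag_mem γ 0 (evenProj_mem t)),
    oddProj_of_odd (diag_mem γ 1 (oddProj_mem t)), zero_add]

end EquivariantMap

/-- The equivariant map superalgebra `(𝔤 ⊗ A)^Γ`. -/
abbrev EquivariantMap (Γ : Type*) [Group Γ]
    (𝔤 : Type*) [AddCommGroup 𝔤] [Module ℂ 𝔤] [LieSuperalgebra 𝔤]
    [DistribMulAction Γ 𝔤] [LieSuperalgebra.ActsByAut Γ 𝔤]
    (A : Type*) [CommRing A] [Algebra ℂ A] [MulSemiringAction Γ A] [SMulCommClass Γ ℂ A] :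
    Type _ := EquivariantMap.fixed Γ 𝔤 A

namespace EquivariantMap

open LieSuperalgebra

variable {Γ : Type*} [Group Γ] {𝔤 : Type*} [AddCommGroup 𝔤] [Module ℂ 𝔤] [LieSuperalgebra 𝔤]
  [DistribMulAction Γ 𝔤] [ActsByAut Γ 𝔤]
  {A : Type*} [CommRing A] [Algebra ℂ A] [MulSemiringAction Γ A] [SMulCommClass Γ ℂ A]

/-- `(𝔤 ⊗ A)^Γ` is a Lie superalgebra for the grading and the bracket inherited from `𝔤 ⊗ A`. -/
noncomputable instance instLieSuperalgebra : LieSuperalgebra (EquivariantMap Γ 𝔤 A) where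
  gr z := (gr (V := 𝔤 ⊗[ℂ] A) z).comap (fixed Γ 𝔤 A).subtype
  isCompl := by
    refine isCompl_of_maps
      ((evenProj (𝔤 ⊗[ℂ] A)).restrict (p := fixed Γ 𝔤 A) (q := fixed Γ 𝔤 A)
        fun t ht γ => by rw [diag_evenProj, ht γ])
      ((oddProj (𝔤 ⊗[ℂ] A)).restrict (p := fixed Γ 𝔤 A) (q := fixed Γ 𝔤 A)
        fun t ht γ => by rw [diag_oddProj, ht γ])
      (fun t => Subtype.ext (evenProj_add_oddProj _)) (fun t => evenProj_mem (t : 𝔤 ⊗[ℂ] A))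
      (fun t => oddProj_mem (t : 𝔤 ⊗[ℂ] A)) (fun t ht => Subtype.ext (evenProj_of_odd ht))
      (fun t ht => Subtype.ext (oddProj_of_even ht))
  bracket := LinearMap.mk₂ ℂ
    (fun s t => ⟨bracket s.1 t.1, fun γ => by rw [diag_bracket, s.2 γ, t.2 γ]⟩)
    (fun _ _ _ => Subtype.ext (by simp)) (fun _ _ _ => Subtype.ext (by simp))
    (fun _ _ _ => Subtype.ext (by simp)) (fun _ _ _ => Subtype.ext (by simp))
  bracket_mem i j s hs t ht := bracket_mem i j s.1 hs t.1 ht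
  bracket_skew i j s hs t ht := Subtype.ext (bracket_skew i j s.1 hs t.1 ht)
  jacobi i j k s hs t ht u hu := Subtype.ext (jacobi i j k s.1 hs t.1 ht u.1 hu)

variable (Γ 𝔤 A)

/-- `Ann_A(V)`: the sum of all `Γ`-invariant ideals `I` of `A` with `(𝔤 ⊗ I)^Γ · V = 0`. -/
noncomputable def annihilator (V : Type*) [AddCommGroup V] [Module ℂ V] [SuperSpace V]
    [LieSupermodule (EquivariantMap Γ 𝔤 A) V] : Ideal A :=
  sSup {I : Ideal A | (∀ γ : Γ, γ • I = I) ∧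
    ∀ t : EquivariantMap Γ 𝔤 A, (t : 𝔤 ⊗[ℂ] A) ∈ MapSuperalgebra.ofIdeal 𝔤 I →
      ∀ v : V, LieSupermodule.act t v = 0}

/-- The support of a `(𝔤 ⊗ A)^Γ`-module: the maximal ideals of `A` that contain its
annihilator. -/
def support (V : Type*) [AddCommGroup V] [Module ℂ V] [SuperSpace V]
    [LieSupermodule (EquivariantMap Γ 𝔤 A) V] : Set (MaximalSpectrum A) :=
  {𝔪 | annihilator Γ 𝔤 A V ≤ 𝔪.asIdeal}

end EquivariantMap

end MapSuperalgebra

/-! Let I and I' be the annihilators of V and V', and put K = (𝔤 ⊗ I)^Γ, K' = (𝔤 ⊗ I')^Γ, N = (𝔤 ⊗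
II')^Γ. Disjoint supports force I + I' = A, and averaging over Γ turns this into L = K + K' for L =
(𝔤 ⊗ A)^Γ. As K kills V and K' kills V', nontriviality and irreducibility give K'·V = V and show
that V' has no nonzero K-invariants.

Let f be a cocycle. N kills both modules, so f vanishes on [N, N], and this contains (𝔤 ⊗ (II')²)^Γ.
Here freeness enters, through `single_one_mem_span_smul` and `fixedIdeal_mul_le_span_bracket`: 𝔤 is
perfect, and an A-combination of the functions γ ↦ γ • b isolates a single term of the bracket of
two orbit sums. Comaximality splits II' = II'I + II'I'. Bracketing with K' on the first summand, and
with K on the second, lands in (II')², so f vanishes on N by K'·V = V and by the absence of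
K-invariants respectively.

Since [K, K'] ⊆ N, f vanishes on [K, K']. Up to signs, the cocycle condition then reads x ∘ f(y) =
f(x) ∘ y for x in K and y in K'. Hence yv ↦ ±f(y)v is a well-defined map φ on K'·V = V: the
ambiguity is a K-invariant of V', so it is zero. The coboundary of φ is f; this is
`mem_coboundaries₁_of_bracket_eq_zero`. -/

namespace SuperSpace

/-! ### Reduction to homogeneous elements -/

/-- Module and cocycle identities carry signs and are available only for homogeneous elements. This
transfers any additive property from them to a whole graded subspace. -/
theorem IsGraded.induction {V : Type*} [AddCommGroup V] [Module ℂ V] [SuperSpace V]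
    {W : Submodule ℂ V} (hW : IsGraded W) {p : V → Prop} (hadd : ∀ x y, p x → p y → p (x + y))
    (hp : ∀ i, ∀ x ∈ W, x ∈ gr (V := V) i → p x) {x : V} (hx : x ∈ W) : p x := by
  rw [← evenProj_add_oddProj x]
  exact hadd _ _ (hp 0 _ (hW x hx).1 (evenProj_mem x)) (hp 1 _ (hW x hx).2 (oddProj_mem x))

theorem isGraded_top {V : Type*} [AddCommGroup V] [Module ℂ V] [SuperSpace V] :
    IsGraded (⊤ : Submodule ℂ V) := fun _ _ => ⟨trivial, trivial⟩

end SuperSpace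

/-! ### Nontrivial irreducible supermodules -/

namespace LieSupermodule

open LieSuperalgebra

section
variable {L : Type*} [AddCommGroup L] [Module ℂ L] [LieSuperalgebra L]
  {V : Type*} [AddCommGroup V] [Module ℂ V] [SuperSpace V] [LieSupermodule L V]

theorem evenProj_act {i : ZMod 2} {x : L} (hx : x ∈ gr (V := L) i) (v : V) :
    evenProj V (act x v) = act x (evenProj V v) ∨ evenProj V (act x v) = act x (oddProj V v) := by
  have h := evenProj_add_oddProj v
  rcases zmod2_cases i with rfl | rfl
  · left
    conv_lhs => rw [← h, map_add, map_add, evenProj_of_even (act_mem 0 0 x hx _ (evenProj_mem v)),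
      evenProj_of_odd (act_mem 0 1 x hx _ (oddProj_mem v)), add_zero]
  · right
    conv_lhs => rw [← h, map_add, map_add, evenProj_of_odd (act_mem 1 0 x hx _ (evenProj_mem v)),
      evenProj_of_even (act_mem 1 1 x hx _ (oddProj_mem v)), zero_add]

theorem oddProj_act {i : ZMod 2} {x : L} (hx : x ∈ gr (V := L) i) (v : V) :
    oddProj V (act x v) = act x (oddProj V v) ∨ oddProj V (act x v) = act x (evenProj V v) := by
  have h := evenProj_add_oddProj v
  rcases zmod2_cases i with rfl | rfl
  · left
    conv_lhs => rw [← h, map_add, map_add, oddProj_of_even (act_mem 0 0 x hx _ (evenProj_mem v)),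
      oddProj_of_odd (act_mem 0 1 x hx _ (oddProj_mem v)), zero_add]
  · right
    conv_lhs => rw [← h, map_add, map_add, oddProj_of_odd (act_mem 1 0 x hx _ (evenProj_mem v)),
      oddProj_of_even (act_mem 1 1 x hx _ (oddProj_mem v)), add_zero]

/-- A nontrivial irreducible module satisfies `L · V = V`. -/
theorem IsIrreducible.span_act_eq_top (hV : IsIrreducible L V) (hnt : ¬ IsTrivial L V) :
    Submodule.span ℂ {w : V | ∃ (x : L) (v : V), w = act x v} = ⊤ := by
  have hmem : ∀ (x : L) (v : V),
      act x v ∈ Submodule.span ℂ {w : V | ∃ (x : L) (v : V), w = act x v} :=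
    fun x v => Submodule.subset_span ⟨x, v, rfl⟩
  -- L · V is a graded submodule; it is nonzero because the action is nontrivial.
  refine (hV.2 _ ?_ fun x w _ => hmem x w).resolve_left fun h => hnt fun x v => ?_
  · intro w hw
    induction hw using Submodule.span_induction with
    | zero => simp
    | add x y _ _ hx hy =>
      simp only [map_add]
      exact ⟨Submodule.add_mem _ hx.1 hy.1, Submodule.add_mem _ hx.2 hy.2⟩
    | smul c x _ hx =>
      simp only [map_smul]
      exact ⟨Submodule.smul_mem _ _ hx.1, Submodule.smul_mem _ _ hx.2⟩
    | mem w hw =>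
      obtain ⟨x, v, rfl⟩ := hw
      refine isGraded_top.induction (x := x)
        (p := fun x => evenProj V (act x v) ∈ _ ∧ oddProj V (act x v) ∈ _) ?_ ?_ trivial
      · intro x y hx hy
        simp only [map_add, LinearMap.add_apply]
        exact ⟨Submodule.add_mem _ hx.1 hy.1, Submodule.add_mem _ hx.2 hy.2⟩
      · intro i x _ hx
        constructor
        · rcases evenProj_act hx v with h | h <;> rw [h] <;> exact hmem _ _
        · rcases oddProj_act hx v with h | h <;> rw [h] <;> exact hmem _ _
  · simpa [h] using hmem x v

/-- A nontrivial irreducible module has no nonzero invariants. -/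
theorem IsIrreducible.eq_zero_of_act_eq_zero (hV : IsIrreducible L V) (hnt : ¬ IsTrivial L V)
    {v : V} (hv : ∀ x : L, act x v = 0) : v = 0 := by
  let W : Submodule ℂ V :=
    { carrier := {v | ∀ x : L, act x v = 0}
      zero_mem' := fun x => map_zero _
      add_mem' := fun ha hb x => by rw [map_add, ha x, hb x, add_zero]
      smul_mem' := fun c _ ha x => by rw [map_smul, ha x, smul_zero] }
  have hW : W = ⊥ ∨ W = ⊤ := by
    refine hV.2 W ?_ ?_
    · intro w hw
      -- Parity commutes with homogeneous elements up to sign, so it preserves the invariants; the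
      -- homogeneous components are (w ± parity w)/2, hence invariant too.
      have key : ∀ x : L, act x (parity V w) = 0 := fun x => by
        refine isGraded_top.induction (x := x) (p := fun x => act x (parity V w) = 0) ?_ ?_ trivial
        · intro x y hx hy
          rw [map_add, LinearMap.add_apply, hx, hy, add_zero]
        · intro i x _ hx
          rw [act_parity hx, hw x, map_zero, smul_zero]
      have hsum := evenProj_add_oddProj w
      have hdiff : evenProj V w - oddProj V w = parity V w := rfl
      constructor
      · have : evenProj V w = (2⁻¹ : ℂ) • (w + parity V w) := by
          rw [← hdiff]; nth_rw 2 [← hsum]; module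
        intro x
        rw [this, map_smul, map_add, hw x, key x, add_zero, smul_zero]
      · have : oddProj V w = (2⁻¹ : ℂ) • (w - parity V w) := by
          rw [← hdiff]; nth_rw 2 [← hsum]; module
        intro x
        rw [this, map_smul, map_sub, hw x, key x, sub_zero, smul_zero]
    · intro x w hw y
      rw [hw x, map_zero]
  rcases hW with h | h
  · exact (Submodule.mem_bot ℂ).1 (h ▸ (show v ∈ W from hv))
  · exact absurd (fun x v => (h ▸ trivial : v ∈ W) x) hnt

end

/-! ### Cocycles and signs -/

section ParityTwist
variable {L : Type*} [AddCommGroup L] [Module ℂ L] [LieSuperalgebra L]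
  {V : Type*} [AddCommGroup V] [Module ℂ V] [SuperSpace V]
  {U : Type*} [AddCommGroup U] [Module ℂ U] [SuperSpace U]

/-- The linear map `x ↦ (-1)^{|x|+1} f(x)`, twisted by the parities in odd degree. -/
noncomputable def parityTwist (f : L →ₗ[ℂ] (V →ₗ[ℂ] U)) : L →ₗ[ℂ] (V →ₗ[ℂ] U) :=
  (parity V).lcomp ℂ U ∘ₗ (parity U).compRight ℂ ∘ₗ f ∘ₗ oddProj L - f ∘ₗ evenProj L

theorem parityTwist_even (f : L →ₗ[ℂ] (V →ₗ[ℂ] U)) {x : L} (hx : x ∈ gr (V := L) 0) (v : V) :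
    parityTwist f x v = -f x v := by
  simp [parityTwist, evenProj_of_even hx, oddProj_of_even hx]

theorem parityTwist_odd (f : L →ₗ[ℂ] (V →ₗ[ℂ] U)) {x : L} (hx : x ∈ gr (V := L) 1) (v : V) :
    parityTwist f x v = parity U (f x (parity V v)) := by
  simp [parityTwist, evenProj_of_odd hx, oddProj_of_odd hx]

end ParityTwist

section Cocycle
variable {L : Type*} [AddCommGroup L] [Module ℂ L] [LieSuperalgebra L]
  {V : Type*} [AddCommGroup V] [Module ℂ V] [SuperSpace V] [LieSupermodule L V]
  {U : Type*} [AddCommGroup U] [Module ℂ U] [SuperSpace U] [LieSupermodule L U]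

/-- Moving the parity past an odd element turns the minus sign into a plus. Evaluated at `parity V
v`, the last term then involves `act x v` itself. -/
theorem homAct_odd' {x : L} (hx : x ∈ gr (V := L) 1) (φ : V →ₗ[ℂ] U) (v : V) :
    homAct x φ v = act x (φ v) + parity U (φ (act x (parity V v))) := by
  rw [homAct_odd hx, act_parity hx]
  simp [sub_eq_add_neg]

theorem homAct_eq_zero {i : ZMod 2} {x : L} (hx : x ∈ gr (V := L) i)
    (hxV : ∀ v : V, act x v = 0) (hxU : ∀ u : U, act x u = 0) (φ : V →ₗ[ℂ] U) :
    homAct x φ = 0 := by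
  ext v
  rcases zmod2_cases i with rfl | rfl
  · simp [homAct_even hx, hxV, hxU]
  · simp [homAct_odd hx, hxV, hxU]

/-- The cocycle condition, for homogeneous arguments. -/
theorem cocycle_apply {f : L →ₗ[ℂ] (V →ₗ[ℂ] U)} (hf : f ∈ cocycles₁ L (V →ₗ[ℂ] U))
    {i j : ZMod 2} {x y : L} (hx : x ∈ gr (V := L) i) (hy : y ∈ gr (V := L) j) :
    f (bracket x y) = homAct x (f y) - superSign i j • homAct y (f x) :=
  hf i j x hx y hy

/-- Elements killing both V and U act by zero on Hom(V, U), so both terms of the cocycle identity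
vanish. -/
theorem cocycle_bracket_eq_zero {f : L →ₗ[ℂ] (V →ₗ[ℂ] U)} (hf : f ∈ cocycles₁ L (V →ₗ[ℂ] U))
    {N : Submodule ℂ L} (hN : IsGraded N) (hNV : ∀ x ∈ N, ∀ v : V, act x v = 0)
    (hNU : ∀ x ∈ N, ∀ u : U, act x u = 0) {x y : L} (hx : x ∈ N) (hy : y ∈ N) :
    f (bracket x y) = 0 := by
  refine hN.induction (p := fun x => f (bracket x y) = 0) ?_ ?_ hx
  · intro x x' h h'
    rw [map_add, LinearMap.add_apply, map_add, h, h', add_zero]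
  intro i x hx hxi
  refine hN.induction (p := fun y => f (bracket x y) = 0) ?_ ?_ hy
  · intro y y' h h'
    rw [map_add, map_add, h, h', add_zero]
  intro j y hy hyj
  rw [cocycle_apply hf hxi hyj, homAct_eq_zero hxi (hNV x hx) (hNU x hx),
    homAct_eq_zero hyj (hNV y hy) (hNU y hy), smul_zero, sub_zero]

theorem homAct_eq_zero_of_cocycle {f : L →ₗ[ℂ] (V →ₗ[ℂ] U)}
    (hf : f ∈ cocycles₁ L (V →ₗ[ℂ] U)) {i j : ZMod 2} {x n : L} (hx : x ∈ gr (V := L) i)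
    (hn : n ∈ gr (V := L) j) (hnV : ∀ v : V, act n v = 0) (hnU : ∀ u : U, act n u = 0)
    (h : f (bracket x n) = 0) : homAct x (f n) = 0 := by
  rwa [cocycle_apply hf hx hn, homAct_eq_zero hn hnV hnU, smul_zero, sub_zero] at h

/-- If `K` annihilates `U` and `K · V = V`, then a cocycle vanishes on each `N` that acts
trivially, as soon as it vanishes on `[K, N]`. -/
theorem cocycle_eq_zero_of_span_eq_top {f : L →ₗ[ℂ] (V →ₗ[ℂ] U)}
    (hf : f ∈ cocycles₁ L (V →ₗ[ℂ] U)) {K N : Submodule ℂ L} (hK : IsGraded K) (hN : IsGraded N)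
    (hNV : ∀ x ∈ N, ∀ v : V, act x v = 0) (hNU : ∀ x ∈ N, ∀ u : U, act x u = 0)
    (hKU : ∀ x ∈ K, ∀ u : U, act x u = 0)
    (hKV : Submodule.span ℂ {w : V | ∃ x ∈ K, ∃ v : V, w = act x v} = ⊤)
    (h : ∀ x ∈ K, ∀ n ∈ N, f (bracket x n) = 0) {n : L} (hn : n ∈ N) : f n = 0 := by
  refine hN.induction (p := fun n => f n = 0) (fun x y hx hy => by rw [map_add, hx, hy, add_zero])
    ?_ hn
  intro j n hn hnj
  -- As x in K kills U, the vanishing of x · f(n) says that f(n) ∘ x is zero, up to sign and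
  -- parities. So f(n) vanishes on K · V, which is everything.
  refine LinearMap.ext_on hKV ?_
  rintro _ ⟨x, hx, v, rfl⟩
  rw [LinearMap.zero_apply]
  refine hK.induction (p := fun x => f n (act x v) = 0) ?_ ?_ hx
  · intro x y hx hy
    rw [map_add, LinearMap.add_apply, map_add, hx, hy, add_zero]
  intro i x hx hxi
  have h0 := homAct_eq_zero_of_cocycle hf hxi hnj (hNV n hn) (hNU n hn) (h x hx n hn)
  rcases zmod2_cases i with rfl | rfl
  · simpa [homAct_even hxi, hKU x hx] using LinearMap.congr_fun h0 v
  · have h1 := LinearMap.congr_fun h0 (parity V v)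
    rw [homAct_odd' hxi, hKU x hx, parity_parity, zero_add, LinearMap.zero_apply] at h1
    rw [← parity_parity (f n _), h1, map_zero]

/-- If `K` annihilates `V` and `U` has no nonzero `K`-invariants, then a cocycle vanishes on each
`N` that acts trivially, as soon as it vanishes on `[K, N]`. -/
theorem cocycle_eq_zero_of_invariants_eq_zero {f : L →ₗ[ℂ] (V →ₗ[ℂ] U)}
    (hf : f ∈ cocycles₁ L (V →ₗ[ℂ] U)) {K N : Submodule ℂ L} (hK : IsGraded K) (hN : IsGraded N)
    (hNV : ∀ x ∈ N, ∀ v : V, act x v = 0) (hNU : ∀ x ∈ N, ∀ u : U, act x u = 0)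
    (hKV : ∀ x ∈ K, ∀ v : V, act x v = 0)
    (hKU : ∀ u : U, (∀ x ∈ K, act x u = 0) → u = 0)
    (h : ∀ x ∈ K, ∀ n ∈ N, f (bracket x n) = 0) {n : L} (hn : n ∈ N) : f n = 0 := by
  refine hN.induction (p := fun n => f n = 0) (fun x y hx hy => by rw [map_add, hx, hy, add_zero])
    ?_ hn
  intro j n hn hnj
  ext v
  -- As x in K kills V, x · f(n) is just x ∘ f(n); its vanishing places the image of f(n) in the
  -- K-invariants.
  refine hKU _ fun x hx => ?_
  refine hK.induction (p := fun x => act x (f n v) = 0) ?_ ?_ hx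
  · intro x y hx hy
    rw [map_add, LinearMap.add_apply, hx, hy, add_zero]
  intro i x hx hxi
  have h0 := LinearMap.congr_fun
    (homAct_eq_zero_of_cocycle hf hxi hnj (hNV n hn) (hNU n hn) (h x hx n hn)) v
  rcases zmod2_cases i with rfl | rfl
  · simpa [homAct_even hxi, hKV x hx] using h0
  · simpa [homAct_odd hxi, hKV x hx] using h0

/-- With f([x, y]) = 0 the cocycle identity equates x · f(y) and ±y · f(x); one term of each drops
out because x kills V and y kills U. The twist absorbs all remaining signs, without assuming f
homogeneous. -/
theorem act_parityTwist {f : L →ₗ[ℂ] (V →ₗ[ℂ] U)}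
    (hf : f ∈ cocycles₁ L (V →ₗ[ℂ] U)) {i j : ZMod 2} {x y : L}
    (hx : x ∈ gr (V := L) i) (hy : y ∈ gr (V := L) j)
    (hxV : ∀ v : V, act x v = 0) (hyU : ∀ u : U, act y u = 0)
    (h : f (bracket x y) = 0) (v : V) : act x (parityTwist f y v) = f x (act y v) := by
  rw [cocycle_apply hf hx hy, sub_eq_zero] at h
  have hl : ∀ v, homAct x (f y) v = act x (f y v) := fun v => by
    rcases zmod2_cases i with rfl | rfl
    · simp [homAct_even hx, hxV]
    · simp [homAct_odd hx, hxV]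
  rcases zmod2_cases j with rfl | rfl
  · have h1 := LinearMap.congr_fun h v
    rw [hl] at h1
    rw [parityTwist_even f hy, map_neg, h1]
    simp [homAct_even hy, hyU]
  · have h1 := LinearMap.congr_fun h (parity V v)
    rw [hl] at h1
    rw [parityTwist_odd f hy, act_parity hx, h1, LinearMap.smul_apply, homAct_odd' hy, hyU,
      parity_parity, zero_add, map_smul, parity_parity]
    rcases zmod2_cases i with rfl | rfl <;> simp

/-- The primitive φ must satisfy φ(yv) = F(y)v for y in K', where F = `parityTwist f`. Since x F(y)v
= f(x)(yv) for x in K, a relation ∑ yv = 0 makes ∑ F(y)v a K-invariant, hence zero. -/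
theorem mem_coboundaries₁_of_bracket_eq_zero {f : L →ₗ[ℂ] (V →ₗ[ℂ] U)}
    (hf : f ∈ cocycles₁ L (V →ₗ[ℂ] U)) {K K' : Submodule ℂ L}
    (hK : IsGraded K) (hK' : IsGraded K') (hsup : K ⊔ K' = ⊤)
    (hKV : ∀ x ∈ K, ∀ v : V, act x v = 0) (hKU : ∀ x ∈ K', ∀ u : U, act x u = 0)
    (hspan : Submodule.span ℂ {w : V | ∃ x ∈ K', ∃ v : V, w = act x v} = ⊤)
    (hinv : ∀ u : U, (∀ x ∈ K, act x u = 0) → u = 0)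
    (h : ∀ x ∈ K, ∀ y ∈ K', f (bracket x y) = 0) :
    f ∈ coboundaries₁ L (V →ₗ[ℂ] U) := by
  have key : ∀ x ∈ K, ∀ y ∈ K', ∀ v, act x (parityTwist f y v) = f x (act y v) := by
    intro x hx y hy v
    refine hK.induction (p := fun x => act x (parityTwist f y v) = f x (act y v)) ?_ ?_ hx
    · intro x x' h h'
      simp only [map_add, LinearMap.add_apply, h, h']
    intro i x hx hxi
    refine hK'.induction (p := fun y => act x (parityTwist f y v) = f x (act y v)) ?_ ?_ hy
    · intro x x' h h'
      simp only [map_add, LinearMap.add_apply, h, h']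
    intro j y hy hyj
    exact act_parityTwist hf hxi hyj (hKV x hx) (hKU y hy) (h x hx y hy) v
  let T : K' ⊗[ℂ] V →ₗ[ℂ] V := TensorProduct.lift ((act (L := L) (V := V)).domRestrict K')
  let G : K' ⊗[ℂ] V →ₗ[ℂ] U := TensorProduct.lift ((parityTwist f).domRestrict K')
  have hT : Function.Surjective T := by
    rw [← LinearMap.range_eq_top, eq_top_iff, ← hspan, Submodule.span_le]
    rintro _ ⟨x, hx, v, rfl⟩
    exact ⟨(⟨x, hx⟩ : K') ⊗ₜ v, by simp [T]⟩
  have hTG : ∀ x ∈ K, ∀ t, act x (G t) = f x (T t) := by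
    intro x hx t
    induction t using TensorProduct.induction_on with
    | zero => simp
    | add s t hs ht => simp only [map_add, hs, ht]
    | tmul y v => simpa [T, G] using key x hx y y.2 v
  -- G descends along the surjection T to φ, realised as G ∘ s for a linear section s; `hφ` is
  -- independence of the chosen lift.
  obtain ⟨s, hs⟩ := T.exists_rightInverse_of_surjective (LinearMap.range_eq_top.2 hT)
  have hφ : ∀ t, G (s (T t)) = G t := fun t => by
    rw [← sub_eq_zero, ← map_sub]
    refine hinv _ fun x hx => ?_
    rw [hTG x hx, map_sub, show T (s (T t)) = T t from LinearMap.congr_fun hs (T t), sub_self,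
      map_zero]
  have hφ1 : ∀ x ∈ K, ∀ v, act x (G (s v)) = f x v := fun x hx v => by
    rw [hTG x hx, show T (s v) = v from LinearMap.congr_fun hs v]
  have hφ2 : ∀ y ∈ K', ∀ v, G (s (act y v)) = parityTwist f y v := fun y hy v => by
    simpa [T, G] using hφ ((⟨y, hy⟩ : K') ⊗ₜ v)
  refine ⟨G ∘ₗ s, ?_⟩
  ext x v
  change homAct x (G ∘ₗ s) v = f x v
  obtain ⟨x, hx, y, hy, rfl⟩ := Submodule.mem_sup.1 (hsup ▸ trivial : x ∈ K ⊔ K')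
  have h1 : homAct x (G ∘ₗ s) v = f x v := by
    refine hK.induction (p := fun x => homAct x (G ∘ₗ s) v = f x v) ?_ ?_ hx
    · intro x x' h h'
      simp only [map_add, LinearMap.add_apply, h, h']
    intro i x hx hxi
    rw [← hφ1 x hx v]
    rcases zmod2_cases i with rfl | rfl
    · simp [homAct_even hxi, hKV x hx]
    · simp [homAct_odd hxi, hKV x hx]
  have h2 : homAct y (G ∘ₗ s) v = f y v := by
    refine hK'.induction (p := fun x => homAct x (G ∘ₗ s) v = f x v) ?_ ?_ hy
    · intro x x' h h'
      simp only [map_add, LinearMap.add_apply, h, h']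
    intro i x hx hxi
    -- The twist was designed for this: φ ∘ y = F(y) is exactly y · φ = f(y), in either degree.
    rcases zmod2_cases i with rfl | rfl
    · rw [homAct_even hxi, hKU x hx, LinearMap.comp_apply, hφ2 x hx, parityTwist_even f hxi]
      simp
    · rw [homAct_odd' hxi, hKU x hx, LinearMap.comp_apply, hφ2 x hx, parityTwist_odd f hxi,
        parity_parity, parity_parity, zero_add]
  simp only [map_add, LinearMap.add_apply, h1, h2]

end Cocycle

end LieSupermodule
-- Free actions on maximal ideals, and perfectness
-- If γ acted trivially modulo 𝔪, then 𝔪 would be contained in the proper ideal γ • 𝔪, and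
-- maximality would give equality.
theorem Ideal.exists_smul_sub_not_mem {Γ A : Type*} [Group Γ] [CommRing A]
    [MulSemiringAction Γ A] {γ : Γ} {𝔪 : Ideal A} (h𝔪 : 𝔪.IsMaximal) (h : γ • 𝔪 ≠ 𝔪) :
    ∃ b : A, b - γ • b ∉ 𝔪 := by
  by_contra! hb
  refine h ((h𝔪.eq_of_le ?_ ?_).symm)
  · rw [Ne, Ideal.eq_top_iff_one]
    intro h1
    refine h𝔪.ne_top ((Ideal.eq_top_iff_one _).2 ?_)
    simpa using Ideal.mem_pointwise_smul_iff_inv_smul_mem.1 h1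
  · intro a ha
    rw [Ideal.mem_pointwise_smul_iff_inv_smul_mem]
    have := 𝔪.add_mem (hb (γ⁻¹ • a)) ha
    simpa using this

/-- If `Γ` acts freely on the maximal ideals of `A`, then the delta function at `1` is an
`A`-linear combination of the functions `γ ↦ γ • b`, for `b` in `A`. -/
theorem single_one_mem_span_smul {Γ A : Type*} [Group Γ] [Finite Γ] [DecidableEq Γ] [CommRing A]
    [MulSemiringAction Γ A]
    (hfree : ∀ γ : Γ, γ ≠ 1 → ∀ 𝔪 : Ideal A, 𝔪.IsMaximal → γ • 𝔪 ≠ 𝔪) :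
    (Pi.single 1 1 : Γ → A) ∈ Submodule.span A (Set.range fun (b : A) (γ : Γ) => γ • b) := by
  classical
  cases nonempty_fintype Γ
  let e : A →* (Γ → A) :=
    { toFun := fun b γ => γ • b
      map_one' := by ext; simp
      map_mul' := fun a b => by ext; simp }
  let S : Subalgebra A (Γ → A) := Algebra.adjoin A (MonoidHom.mrange e : Set (Γ → A))
  -- The functions γ ↦ γ • b are closed under products, so their A-span is already a subalgebra.
  have hS : S.toSubmodule = Submodule.span A (Set.range fun (b : A) (γ : Γ) => γ • b) := by
    rw [Algebra.adjoin_eq_span, Submonoid.closure_eq]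
    rfl
  rw [← hS]
  have heS : ∀ b, e b ∈ S := fun b => Algebra.subset_adjoin ⟨b, rfl⟩
  have hsep : ∀ γ : Γ, γ ≠ 1 → ∃ s ∈ S, s 1 = 1 ∧ s γ = 0 := by
    intro γ hγ
    let D : Ideal A := Ideal.span (Set.range fun b : A => b - γ • b)
    have hD : D = ⊤ := by
      by_contra hD
      obtain ⟨𝔪, h𝔪, hle⟩ := Ideal.exists_le_maximal D hD
      obtain ⟨b, hb⟩ := Ideal.exists_smul_sub_not_mem h𝔪 (hfree γ hγ 𝔪 h𝔪)
      exact hb (hle (Ideal.subset_span ⟨b, rfl⟩))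
    have key : ∀ d ∈ D, ∃ s ∈ S, s 1 = d ∧ s γ = 0 := by
      intro d hd
      induction hd using Submodule.span_induction with
      | zero => exact ⟨0, S.zero_mem, rfl, rfl⟩
      | add x y _ _ hx hy =>
        obtain ⟨s, hs, hs1, hs0⟩ := hx
        obtain ⟨t, ht, ht1, ht0⟩ := hy
        exact ⟨s + t, S.add_mem hs ht, by simp [hs1, ht1], by simp [hs0, ht0]⟩
      | smul c x _ hx =>
        obtain ⟨s, hs, hs1, hs0⟩ := hx
        exact ⟨c • s, S.smul_mem hs c, by simp [hs1], by simp [hs0]⟩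
      | mem x hx =>
        obtain ⟨b, rfl⟩ := hx
        -- Subtracting the constant γ • b gives the value 0 at γ and b - γ • b at 1.
        refine ⟨e b - algebraMap A _ (γ • b), S.sub_mem (heS b) (S.algebraMap_mem _), ?_, ?_⟩
        · simp [e]
        · simp [e]
    exact key 1 (hD ▸ trivial)
  choose! s hs hs1 hs0 using hsep
  -- Each factor is 1 at the identity and kills one other point.
  have hprod : ∏ γ ∈ Finset.univ.erase (1 : Γ), s γ = Pi.single 1 1 := by
    ext δ
    rw [Finset.prod_apply]
    by_cases hδ : δ = 1
    · subst hδ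
      rw [Pi.single_eq_same]
      exact Finset.prod_eq_one fun γ hγ => hs1 γ (Finset.ne_of_mem_erase hγ)
    · rw [Pi.single_eq_of_ne hδ]
      exact Finset.prod_eq_zero (Finset.mem_erase.2 ⟨hδ, Finset.mem_univ δ⟩) (hs0 δ hδ)
  rw [← hprod]
  exact S.prod_mem fun γ hγ => hs γ (Finset.ne_of_mem_erase hγ)

/-- A simple Lie superalgebra is perfect. -/
theorem LieSuperalgebra.IsSimple.span_bracket_eq_top {L : Type*} [AddCommGroup L] [Module ℂ L]
    [LieSuperalgebra L] (hL : IsSimple L) :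
    Submodule.span ℂ {z : L | ∃ x y : L, z = bracket x y} = ⊤ := by
  have hmem : ∀ x y : L, bracket x y ∈ Submodule.span ℂ {z : L | ∃ x y : L, z = bracket x y} :=
    fun x y => Submodule.subset_span ⟨x, y, rfl⟩
  obtain ⟨⟨x, y, hxy⟩, h⟩ := hL
  -- The span of the brackets is a graded ideal, nonzero because the algebra is not abelian.
  refine (h _ ?_ fun x w _ => hmem x w).resolve_left fun h => hxy ?_
  · intro w hw
    induction hw using Submodule.span_induction with
    | zero => simp
    | add x y _ _ hx hy =>
      simp only [map_add]
      exact ⟨Submodule.add_mem _ hx.1 hy.1, Submodule.add_mem _ hx.2 hy.2⟩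
    | smul c x _ hx =>
      simp only [map_smul]
      exact ⟨Submodule.smul_mem _ _ hx.1, Submodule.smul_mem _ _ hx.2⟩
    | mem w hw =>
      obtain ⟨x, y, rfl⟩ := hw
      let p : L → Prop := fun z =>
        evenProj L z ∈ Submodule.span ℂ {z : L | ∃ x y : L, z = bracket x y} ∧
        oddProj L z ∈ Submodule.span ℂ {z : L | ∃ x y : L, z = bracket x y}
      have hp : ∀ z z', p z → p z' → p (z + z') := by
        intro z z' h h'
        simp only [p, map_add]
        exact ⟨Submodule.add_mem _ h.1 h'.1, Submodule.add_mem _ h.2 h'.2⟩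
      change p (bracket x y)
      refine isGraded_top.induction (p := fun x => p (bracket x y)) (fun x x' h h' => ?_)
        (fun i x _ hx => ?_) (Submodule.mem_top (x := x))
      · rw [map_add, LinearMap.add_apply]; exact hp _ _ h h'
      refine isGraded_top.induction (p := fun y => p (bracket x y)) (fun y y' h h' => ?_)
        (fun j y _ hy => ?_) (Submodule.mem_top (x := y))
      · rw [map_add]; exact hp _ _ h h'
      have hb := bracket_mem i j x hx y hy
      rcases zmod2_cases (i + j) with h | h <;> rw [h] at hb
      · refine ⟨?_, ?_⟩
        · rw [evenProj_of_even hb]; exact hmem x y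
        · rw [oddProj_of_even hb]; exact Submodule.zero_mem _
      · refine ⟨?_, ?_⟩
        · rw [evenProj_of_odd hb]; exact Submodule.zero_mem _
        · rw [oddProj_of_odd hb]; exact hmem x y
  · simpa [h] using hmem x y

/-! ### The subspaces 𝔤 ⊗ I -/

namespace MapSuperalgebra

variable {𝔤 : Type*} [AddCommGroup 𝔤] [Module ℂ 𝔤] [LieSuperalgebra 𝔤]
  {A : Type*} [CommRing A] [Algebra ℂ A]

theorem tmul_mem_ofIdeal {I : Ideal A} (x : 𝔤) {a : A} (ha : a ∈ I) :
    x ⊗ₜ[ℂ] a ∈ ofIdeal 𝔤 I :=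
  Submodule.subset_span ⟨x, a, ha, rfl⟩

theorem ofIdeal_mono {I J : Ideal A} (h : I ≤ J) : ofIdeal 𝔤 I ≤ ofIdeal 𝔤 J :=
  Submodule.span_mono fun _ ⟨x, a, ha, ht⟩ => ⟨x, a, h ha, ht⟩

theorem mem_ofIdeal_top (t : 𝔤 ⊗[ℂ] A) : t ∈ ofIdeal 𝔤 (⊤ : Ideal A) := by
  induction t using TensorProduct.induction_on with
  | zero => exact Submodule.zero_mem _
  | tmul x a => exact tmul_mem_ofIdeal x trivial
  | add s t hs ht => exact Submodule.add_mem _ hs ht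

theorem bracket_mem_ofIdeal {I J : Ideal A} {s t : 𝔤 ⊗[ℂ] A} (hs : s ∈ ofIdeal 𝔤 I)
    (ht : t ∈ ofIdeal 𝔤 J) : LieSuperalgebra.bracket s t ∈ ofIdeal 𝔤 (I * J) := by
  change bracket 𝔤 A s t ∈ _
  induction hs, ht using Submodule.span_induction₂ with
  | mem_mem s t hs ht =>
    obtain ⟨x, a, ha, rfl⟩ := hs
    obtain ⟨y, b, hb, rfl⟩ := ht
    rw [bracket_tmul]
    exact tmul_mem_ofIdeal _ (Ideal.mul_mem_mul ha hb)
  | zero_left t _ => simp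
  | zero_right s _ => simp
  | add_left s s' t _ _ _ h h' => simpa using Submodule.add_mem _ h h'
  | add_right s t t' _ _ _ h h' => simpa using Submodule.add_mem _ h h'
  | smul_left c s t _ _ h => simpa using Submodule.smul_mem _ c h
  | smul_right c s t _ _ h => simpa using Submodule.smul_mem _ c h

theorem evenProj_tmul (x : 𝔤) (a : A) :
    evenProj (𝔤 ⊗[ℂ] A) (x ⊗ₜ a) = evenProj 𝔤 x ⊗ₜ a := by
  have h0 : evenProj 𝔤 x ⊗ₜ[ℂ] a ∈ gr (V := 𝔤 ⊗[ℂ] A) 0 :=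
    Submodule.subset_span ⟨_, evenProj_mem x, a, rfl⟩
  have h1 : oddProj 𝔤 x ⊗ₜ[ℂ] a ∈ gr (V := 𝔤 ⊗[ℂ] A) 1 :=
    Submodule.subset_span ⟨_, oddProj_mem x, a, rfl⟩
  conv_lhs => rw [← evenProj_add_oddProj x, TensorProduct.add_tmul, map_add,
    evenProj_of_even h0, evenProj_of_odd h1, add_zero]

theorem isGraded_ofIdeal (I : Ideal A) : IsGraded (ofIdeal 𝔤 I) := by
  have h : ∀ t ∈ ofIdeal 𝔤 I, evenProj (𝔤 ⊗[ℂ] A) t ∈ ofIdeal 𝔤 I := by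
    intro t ht
    induction ht using Submodule.span_induction with
    | zero => simp
    | add x y _ _ hx hy => rw [map_add]; exact Submodule.add_mem _ hx hy
    | smul c x _ hx => rw [map_smul]; exact Submodule.smul_mem _ _ hx
    | mem w hw =>
      obtain ⟨x, a, ha, rfl⟩ := hw
      rw [evenProj_tmul]
      exact tmul_mem_ofIdeal _ ha
  intro t ht
  refine ⟨h t ht, ?_⟩
  rw [← add_sub_cancel_left (evenProj _ t) (oddProj _ t), evenProj_add_oddProj]
  exact Submodule.sub_mem _ ht (h t ht)

end MapSuperalgebra

/-! ### Fixed points and averaging over Γ -/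

namespace EquivariantMap

open LieSuperalgebra MapSuperalgebra

variable {Γ : Type*} [Group Γ] {𝔤 : Type*} [AddCommGroup 𝔤] [Module ℂ 𝔤] [LieSuperalgebra 𝔤]
  [DistribMulAction Γ 𝔤] [ActsByAut Γ 𝔤]
  {A : Type*} [CommRing A] [Algebra ℂ A] [MulSemiringAction Γ A] [SMulCommClass Γ ℂ A]

theorem coe_bracket (s t : EquivariantMap Γ 𝔤 A) :
    ((bracket s t : EquivariantMap Γ 𝔤 A) : 𝔤 ⊗[ℂ] A) = bracket (s : 𝔤 ⊗[ℂ] A) t := rfl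

theorem coe_evenProj (t : EquivariantMap Γ 𝔤 A) :
    (evenProj (EquivariantMap Γ 𝔤 A) t : 𝔤 ⊗[ℂ] A) = evenProj _ (t : 𝔤 ⊗[ℂ] A) := by
  have h0 : (evenProj (EquivariantMap Γ 𝔤 A) t : 𝔤 ⊗[ℂ] A) ∈ gr (V := 𝔤 ⊗[ℂ] A) 0 :=
    evenProj_mem t
  have h1 : (oddProj (EquivariantMap Γ 𝔤 A) t : 𝔤 ⊗[ℂ] A) ∈ gr (V := 𝔤 ⊗[ℂ] A) 1 :=
    oddProj_mem t
  conv_rhs => rw [← evenProj_add_oddProj t, Submodule.coe_add, map_add, evenProj_of_even h0,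
    evenProj_of_odd h1, add_zero]

theorem coe_oddProj (t : EquivariantMap Γ 𝔤 A) :
    (oddProj (EquivariantMap Γ 𝔤 A) t : 𝔤 ⊗[ℂ] A) = oddProj _ (t : 𝔤 ⊗[ℂ] A) := by
  have h0 : (evenProj (EquivariantMap Γ 𝔤 A) t : 𝔤 ⊗[ℂ] A) ∈ gr (V := 𝔤 ⊗[ℂ] A) 0 :=
    evenProj_mem t
  have h1 : (oddProj (EquivariantMap Γ 𝔤 A) t : 𝔤 ⊗[ℂ] A) ∈ gr (V := 𝔤 ⊗[ℂ] A) 1 :=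
    oddProj_mem t
  conv_rhs => rw [← evenProj_add_oddProj t, Submodule.coe_add, map_add, oddProj_of_even h0,
    oddProj_of_odd h1, zero_add]

variable (Γ 𝔤) in
/-- The subspace `(𝔤 ⊗ I)^Γ` of `(𝔤 ⊗ A)^Γ`. -/
noncomputable def fixedIdeal (I : Ideal A) : Submodule ℂ (EquivariantMap Γ 𝔤 A) :=
  (ofIdeal 𝔤 I).comap (fixed Γ 𝔤 A).subtype

theorem isGraded_fixedIdeal (I : Ideal A) : IsGraded (fixedIdeal Γ 𝔤 I) := by
  intro t ht
  constructor
  · change (evenProj (EquivariantMap Γ 𝔤 A) t : 𝔤 ⊗[ℂ] A) ∈ ofIdeal 𝔤 I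
    rw [coe_evenProj]
    exact (isGraded_ofIdeal I _ ht).1
  · change (oddProj (EquivariantMap Γ 𝔤 A) t : 𝔤 ⊗[ℂ] A) ∈ ofIdeal 𝔤 I
    rw [coe_oddProj]
    exact (isGraded_ofIdeal I _ ht).2

theorem bracket_mem_fixedIdeal {I J : Ideal A} {s t : EquivariantMap Γ 𝔤 A}
    (hs : s ∈ fixedIdeal Γ 𝔤 I) (ht : t ∈ fixedIdeal Γ 𝔤 J) :
    bracket s t ∈ fixedIdeal Γ 𝔤 (I * J) :=
  bracket_mem_ofIdeal (s := (s : 𝔤 ⊗[ℂ] A)) hs ht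

theorem fixedIdeal_mono {I J : Ideal A} (h : I ≤ J) : fixedIdeal Γ 𝔤 I ≤ fixedIdeal Γ 𝔤 J :=
  Submodule.comap_mono (ofIdeal_mono h)

theorem diag_diag (γ δ : Γ) (t : 𝔤 ⊗[ℂ] A) :
    diag Γ 𝔤 A γ (diag Γ 𝔤 A δ t) = diag Γ 𝔤 A (γ * δ) t := by
  induction t using TensorProduct.induction_on with
  | zero => simp
  | tmul x a => simp [mul_smul]
  | add s t hs ht => simp only [map_add, hs, ht]

section Average
variable [Fintype Γ]

variable (Γ 𝔤 A) in
/-- The sum over the `Γ`-orbit, as a map from `𝔤 ⊗ A` to `(𝔤 ⊗ A)^Γ`. -/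
noncomputable def orbitSum : 𝔤 ⊗[ℂ] A →ₗ[ℂ] EquivariantMap Γ 𝔤 A :=
  (∑ γ : Γ, diag Γ 𝔤 A γ).codRestrict (fixed Γ 𝔤 A) fun t γ => by
    simp only [LinearMap.sum_apply, map_sum, diag_diag]
    exact Fintype.sum_equiv (Equiv.mulLeft γ) _ _ fun _ => rfl

theorem coe_orbitSum (t : 𝔤 ⊗[ℂ] A) :
    (orbitSum Γ 𝔤 A t : 𝔤 ⊗[ℂ] A) = ∑ γ : Γ, diag Γ 𝔤 A γ t := by
  change (∑ γ : Γ, diag Γ 𝔤 A γ) t = _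
  rw [LinearMap.sum_apply]

theorem smul_orbitSum_coe (t : EquivariantMap Γ 𝔤 A) :
    (Fintype.card Γ : ℂ)⁻¹ • orbitSum Γ 𝔤 A t = t := by
  refine Subtype.ext ?_
  rw [Submodule.coe_smul, coe_orbitSum, Finset.sum_congr rfl fun γ _ => t.2 γ, Finset.sum_const,
    Finset.card_univ, ← Nat.cast_smul_eq_nsmul ℂ, smul_smul, inv_mul_cancel₀, one_smul]
  exact Nat.cast_ne_zero.2 Fintype.card_ne_zero

theorem orbitSum_mem_fixedIdeal {I : Ideal A} (hI : ∀ (γ : Γ), ∀ a ∈ I, γ • a ∈ I)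
    {t : 𝔤 ⊗[ℂ] A} (ht : t ∈ ofIdeal 𝔤 I) : orbitSum Γ 𝔤 A t ∈ fixedIdeal Γ 𝔤 I := by
  change (orbitSum Γ 𝔤 A t : 𝔤 ⊗[ℂ] A) ∈ ofIdeal 𝔤 I
  rw [coe_orbitSum]
  refine Submodule.sum_mem _ fun γ _ => ?_
  induction ht using Submodule.span_induction with
  | zero => simp
  | add x y _ _ hx hy => rw [map_add]; exact Submodule.add_mem _ hx hy
  | smul c x _ hx => rw [map_smul]; exact Submodule.smul_mem _ _ hx
  | mem w hw =>
    obtain ⟨x, a, ha, rfl⟩ := hw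
    exact tmul_mem_ofIdeal _ (hI γ a ha)

/-- An element of `(𝔤 ⊗ I)^Γ` lies in each subspace that contains the orbit sums of the elements
`x ⊗ a` with `a` in `I`. -/
theorem fixedIdeal_le_of_orbitSum_mem {I : Ideal A} {W : Submodule ℂ (EquivariantMap Γ 𝔤 A)}
    (h : ∀ (x : 𝔤), ∀ a ∈ I, orbitSum Γ 𝔤 A (x ⊗ₜ a) ∈ W) : fixedIdeal Γ 𝔤 I ≤ W := by
  intro t ht
  rw [← smul_orbitSum_coe t]
  refine Submodule.smul_mem _ _ ?_
  have : ofIdeal 𝔤 I ≤ W.comap (orbitSum Γ 𝔤 A) := by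
    refine Submodule.span_le.2 ?_
    rintro _ ⟨x, a, ha, rfl⟩
    exact h x a ha
  exact this ht

/-- A fixed element of 𝔤 ⊗ (I + J) splits into parts that need not be fixed; averaging them repairs
this because I and J are invariant. -/
theorem fixedIdeal_sup_le {I J : Ideal A} (hI : ∀ (γ : Γ), ∀ a ∈ I, γ • a ∈ I)
    (hJ : ∀ (γ : Γ), ∀ a ∈ J, γ • a ∈ J) :
    fixedIdeal Γ 𝔤 (I ⊔ J) ≤ fixedIdeal Γ 𝔤 I ⊔ fixedIdeal Γ 𝔤 J := by
  refine fixedIdeal_le_of_orbitSum_mem fun x c hc => ?_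
  obtain ⟨a, ha, b, hb, rfl⟩ := Submodule.mem_sup.1 hc
  rw [TensorProduct.tmul_add, map_add]
  exact Submodule.add_mem_sup (orbitSum_mem_fixedIdeal hI (tmul_mem_ofIdeal x ha))
    (orbitSum_mem_fixedIdeal hJ (tmul_mem_ofIdeal x hb))

/-- The bracket is a double sum over Γ × Γ; reindexing by the relative element δ groups it into
orbit sums. -/
theorem bracket_orbitSum (x y : 𝔤) (a b : A) :
    (bracket (orbitSum Γ 𝔤 A (x ⊗ₜ a)) (orbitSum Γ 𝔤 A (y ⊗ₜ b)) : EquivariantMap Γ 𝔤 A) =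
      ∑ δ : Γ, orbitSum Γ 𝔤 A (bracket x (δ • y) ⊗ₜ (a * δ • b)) := by
  refine Subtype.ext ?_
  rw [coe_bracket, Submodule.coe_sum]
  simp only [coe_orbitSum, map_sum, LinearMap.sum_apply]
  rw [Finset.sum_comm]
  conv_rhs => rw [Finset.sum_comm]
  refine Finset.sum_congr rfl fun γ _ => ?_
  refine Fintype.sum_equiv (Equiv.mulLeft γ⁻¹) _ _ fun δ => ?_
  change MapSuperalgebra.bracket 𝔤 A _ _ = _
  simp [ActsByAut.smul_bracket, smul_smul, smul_mul']

/-- For a free action, `(𝔤 ⊗ IJ)^Γ` is spanned by the brackets of `(𝔤 ⊗ I)^Γ` and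
`(𝔤 ⊗ J)^Γ`. -/
theorem fixedIdeal_mul_le_span_bracket (h𝔤 : IsSimple 𝔤)
    (hfree : ∀ γ : Γ, γ ≠ 1 → ∀ 𝔪 : Ideal A, 𝔪.IsMaximal → γ • 𝔪 ≠ 𝔪) {I J : Ideal A}
    (hI : ∀ (γ : Γ), ∀ a ∈ I, γ • a ∈ I) (hJ : ∀ (γ : Γ), ∀ a ∈ J, γ • a ∈ J) :
    fixedIdeal Γ 𝔤 (I * J) ≤ Submodule.span ℂ {t : EquivariantMap Γ 𝔤 A |
      ∃ r ∈ fixedIdeal Γ 𝔤 I, ∃ s ∈ fixedIdeal Γ 𝔤 J, t = bracket r s} := by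
  classical
  set W := Submodule.span ℂ {t : EquivariantMap Γ 𝔤 A |
      ∃ r ∈ fixedIdeal Γ 𝔤 I, ∃ s ∈ fixedIdeal Γ 𝔤 J, t = bracket r s} with hW
  -- A weight u(δ) is inserted in `bracket_orbitSum`. For u(δ) = δ • d the sum is one bracket, with
  -- d absorbed into b; A-scalars are absorbed into a. Taking u to be the delta function leaves only
  -- the term δ = 1.
  have key : ∀ u ∈ Submodule.span A (Set.range fun (b : A) (γ : Γ) => γ • b),
      ∀ (y z : 𝔤), ∀ a ∈ I, ∀ b ∈ J,
        ∑ δ : Γ, orbitSum Γ 𝔤 A (bracket y (δ • z) ⊗ₜ (a * u δ * δ • b)) ∈ W := by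
    intro u hu y z
    induction hu using Submodule.span_induction with
    | zero => simp
    | add u v _ _ hu hv =>
      intro a ha b hb
      simp only [Pi.add_apply, mul_add, add_mul, TensorProduct.tmul_add, map_add,
        Finset.sum_add_distrib]
      exact Submodule.add_mem _ (hu a ha b hb) (hv a ha b hb)
    | smul c u _ hu =>
      intro a ha b hb
      simpa only [Pi.smul_apply, smul_eq_mul, mul_assoc] using hu (a * c) (I.mul_mem_right c ha) b hb
    | mem u hu =>
      obtain ⟨d, rfl⟩ := hu
      intro a ha b hb
      simp only [mul_assoc, ← smul_mul']
      rw [← bracket_orbitSum]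
      exact Submodule.subset_span ⟨_, orbitSum_mem_fixedIdeal hI (tmul_mem_ofIdeal y ha), _,
        orbitSum_mem_fixedIdeal hJ (tmul_mem_ofIdeal z (J.mul_mem_left d hb)), rfl⟩
  have key' : ∀ (y z : 𝔤), ∀ a ∈ I, ∀ b ∈ J,
      orbitSum Γ 𝔤 A (bracket y z ⊗ₜ (a * b)) ∈ W := by
    intro y z a ha b hb
    have h := key _ (single_one_mem_span_smul hfree) y z a ha b hb
    rw [Finset.sum_eq_single (1 : Γ)] at h
    · simpa using h
    · intro δ _ hδ
      simp [Pi.single_eq_of_ne hδ]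
    · simp
  refine fixedIdeal_le_of_orbitSum_mem fun x c hc => ?_
  have hx : x ∈ Submodule.span ℂ {z : 𝔤 | ∃ x y : 𝔤, z = bracket x y} :=
    h𝔤.span_bracket_eq_top ▸ trivial
  induction hx using Submodule.span_induction with
  | zero => simp
  | add x y _ _ hx hy => rw [TensorProduct.add_tmul, map_add]; exact Submodule.add_mem _ hx hy
  | smul r x _ hx => rw [← TensorProduct.smul_tmul', map_smul]; exact Submodule.smul_mem _ _ hx
  | mem x hx =>
    obtain ⟨y, z, rfl⟩ := hx
    induction hc using Submodule.mul_induction_on' with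
    | mem_mul_mem a ha b hb => exact key' y z a ha b hb
    | add a _ b _ h h' => rw [TensorProduct.tmul_add, map_add]; exact Submodule.add_mem _ h h'

end Average

/-! ### Annihilators and supports -/

section Annihilator
variable (Γ 𝔤 A)
  (V : Type*) [AddCommGroup V] [Module ℂ V] [SuperSpace V]
  [LieSupermodule (EquivariantMap Γ 𝔤 A) V]

theorem smul_mem_annihilator (γ : Γ) :
    ∀ a ∈ annihilator Γ 𝔤 A V, γ • a ∈ annihilator Γ 𝔤 A V := by
  have h : annihilator Γ 𝔤 A V ≤
      (annihilator Γ 𝔤 A V).comap (MulSemiringAction.toRingHom Γ A γ) := by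
    refine sSup_le fun I hI a ha => ?_
    refine (le_sSup hI : I ≤ annihilator Γ 𝔤 A V) ?_
    rw [← hI.1 γ]
    exact Ideal.smul_mem_pointwise_smul γ a I ha
  exact fun a ha => h ha

/-- The annihilator is a sum of ideals, and killing V has to be passed to that sum. The elements a
for which all orbit sums of x ⊗ ca act by zero form an ideal B; it contains each summand, and orbit
sums span the fixed points. -/
theorem act_eq_zero_of_mem_fixedIdeal_annihilator [Finite Γ] :
    ∀ t ∈ fixedIdeal Γ 𝔤 (annihilator Γ 𝔤 A V), ∀ v : V, LieSupermodule.act t v = 0 := by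
  cases nonempty_fintype Γ
  let W : Submodule ℂ (EquivariantMap Γ 𝔤 A) :=
    LinearMap.ker (LieSupermodule.act (L := EquivariantMap Γ 𝔤 A) (V := V))
  let B : Ideal A :=
    { carrier := {a | ∀ (c : A) (x : 𝔤), orbitSum Γ 𝔤 A (x ⊗ₜ (c * a)) ∈ W}
      zero_mem' := fun c x => by simp
      add_mem' := fun ha hb c x => by
        rw [mul_add, TensorProduct.tmul_add, map_add]
        exact Submodule.add_mem _ (ha c x) (hb c x)
      smul_mem' := fun d a ha c x => by
        rw [smul_eq_mul, ← mul_assoc]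
        exact ha (c * d) x }
  have hB : annihilator Γ 𝔤 A V ≤ B := by
    refine sSup_le fun I hI a ha c x => ?_
    refine LinearMap.mem_ker.2 (LinearMap.ext fun v => hI.2 _ ?_ v)
    refine orbitSum_mem_fixedIdeal (fun γ b hb => ?_) (tmul_mem_ofIdeal x (I.mul_mem_left c ha))
    rw [← hI.1 γ]
    exact Ideal.smul_mem_pointwise_smul γ b I hb
  have hle : fixedIdeal Γ 𝔤 (annihilator Γ 𝔤 A V) ≤ W :=
    fixedIdeal_le_of_orbitSum_mem fun x a ha => by simpa using hB ha 1 x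
  intro t ht v
  rw [LinearMap.mem_ker.1 (hle ht), LinearMap.zero_apply]

/-- A maximal ideal containing the sum would lie in both supports. -/
theorem annihilator_sup_annihilator_eq_top
    (V' : Type*) [AddCommGroup V'] [Module ℂ V'] [SuperSpace V']
    [LieSupermodule (EquivariantMap Γ 𝔤 A) V']
    (h : Disjoint (support Γ 𝔤 A V) (support Γ 𝔤 A V')) :
    annihilator Γ 𝔤 A V ⊔ annihilator Γ 𝔤 A V' = ⊤ := by
  by_contra hne
  obtain ⟨𝔪, h𝔪, hle⟩ := Ideal.exists_le_maximal _ hne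
  exact Set.disjoint_left.1 h (show ⟨𝔪, h𝔪⟩ ∈ support Γ 𝔤 A V from le_sup_left.trans hle)
    (le_sup_right.trans hle)

end Annihilator

/-! ### Cocycles for comaximal invariant ideals -/

theorem smul_mem_mul {Γ A : Type*} [Group Γ] [CommRing A] [MulSemiringAction Γ A] {P Q : Ideal A}
    (hP : ∀ (γ : Γ), ∀ a ∈ P, γ • a ∈ P) (hQ : ∀ (γ : Γ), ∀ a ∈ Q, γ • a ∈ Q) :
    ∀ (γ : Γ), ∀ a ∈ P * Q, γ • a ∈ P * Q := by
  intro γ c hc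
  induction hc using Submodule.mul_induction_on' with
  | mem_mul_mem a ha b hb => rw [smul_mul']; exact Ideal.mul_mem_mul (hP γ a ha) (hQ γ b hb)
  | add a _ b _ h h' => rw [smul_add]; exact Ideal.add_mem _ h h'

/-- A cocycle with values in `Hom(V, V')`, for nontrivial irreducible modules `V` and `V'`
annihilated by `(𝔤 ⊗ I)^Γ` and `(𝔤 ⊗ I')^Γ` for comaximal ideals, is a coboundary. -/
theorem mem_coboundaries₁_of_sup_eq_top [Finite Γ] (h𝔤 : LieSuperalgebra.IsSimple 𝔤)
    (hfree : ∀ γ : Γ, γ ≠ 1 → ∀ 𝔪 : Ideal A, 𝔪.IsMaximal → γ • 𝔪 ≠ 𝔪)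
    {V : Type*} [AddCommGroup V] [Module ℂ V] [SuperSpace V]
    [LieSupermodule (EquivariantMap Γ 𝔤 A) V]
    {V' : Type*} [AddCommGroup V'] [Module ℂ V'] [SuperSpace V']
    [LieSupermodule (EquivariantMap Γ 𝔤 A) V']
    (hV : LieSupermodule.IsIrreducible (EquivariantMap Γ 𝔤 A) V)
    (hV' : LieSupermodule.IsIrreducible (EquivariantMap Γ 𝔤 A) V')
    (hVnt : ¬ LieSupermodule.IsTrivial (EquivariantMap Γ 𝔤 A) V)
    (hVnt' : ¬ LieSupermodule.IsTrivial (EquivariantMap Γ 𝔤 A) V')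
    {I I' : Ideal A} (hIinv : ∀ (γ : Γ), ∀ a ∈ I, γ • a ∈ I)
    (hI'inv : ∀ (γ : Γ), ∀ a ∈ I', γ • a ∈ I')
    (hKV : ∀ t ∈ fixedIdeal Γ 𝔤 I, ∀ v : V, LieSupermodule.act t v = 0)
    (hKV' : ∀ t ∈ fixedIdeal Γ 𝔤 I', ∀ v : V', LieSupermodule.act t v = 0)
    (htop : I ⊔ I' = ⊤) {f : EquivariantMap Γ 𝔤 A →ₗ[ℂ] (V →ₗ[ℂ] V')}
    (hf : f ∈ LieSupermodule.cocycles₁ (EquivariantMap Γ 𝔤 A) (V →ₗ[ℂ] V')) :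
    f ∈ LieSupermodule.coboundaries₁ (EquivariantMap Γ 𝔤 A) (V →ₗ[ℂ] V') := by
  cases nonempty_fintype Γ
  have hJinv := smul_mem_mul hIinv hI'inv
  have hsup : fixedIdeal Γ 𝔤 I ⊔ fixedIdeal Γ 𝔤 I' = ⊤ := by
    rw [eq_top_iff]
    refine le_trans ?_ (fixedIdeal_sup_le hIinv hI'inv)
    rw [htop]
    exact fun t _ => mem_ofIdeal_top _
  have hspan : Submodule.span ℂ {w : V | ∃ x ∈ fixedIdeal Γ 𝔤 I', ∃ v : V,
      w = LieSupermodule.act x v} = ⊤ := by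
    rw [eq_top_iff, ← hV.span_act_eq_top hVnt, Submodule.span_le]
    rintro _ ⟨t, v, rfl⟩
    obtain ⟨x, hx, y, hy, rfl⟩ := Submodule.mem_sup.1 (hsup ▸ trivial :
      t ∈ fixedIdeal Γ 𝔤 I ⊔ fixedIdeal Γ 𝔤 I')
    refine Submodule.subset_span ⟨y, hy, v, ?_⟩
    rw [map_add, LinearMap.add_apply, hKV x hx, zero_add]
  have hinv : ∀ u : V', (∀ x ∈ fixedIdeal Γ 𝔤 I, LieSupermodule.act x u = 0) →
      u = 0 := by
    refine fun u hu => hV'.eq_zero_of_act_eq_zero hVnt' fun t => ?_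
    obtain ⟨x, hx, y, hy, rfl⟩ := Submodule.mem_sup.1 (hsup ▸ trivial :
      t ∈ fixedIdeal Γ 𝔤 I ⊔ fixedIdeal Γ 𝔤 I')
    rw [map_add, LinearMap.add_apply, hu x hx, hKV' y hy, zero_add]
  have hNV : ∀ P ≤ I * I', ∀ x ∈ fixedIdeal Γ 𝔤 P, ∀ v : V,
      LieSupermodule.act x v = 0 := fun P hP x hx =>
    hKV x (fixedIdeal_mono (hP.trans Ideal.mul_le_left) hx)
  have hNV' : ∀ P ≤ I * I', ∀ x ∈ fixedIdeal Γ 𝔤 P, ∀ v : V',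
      LieSupermodule.act x v = 0 := fun P hP x hx =>
    hKV' x (fixedIdeal_mono (hP.trans Ideal.mul_le_right) hx)
  have hsq : ∀ x ∈ fixedIdeal Γ 𝔤 ((I * I') * (I * I')), f x = 0 := by
    intro x hx
    suffices h : fixedIdeal Γ 𝔤 ((I * I') * (I * I')) ≤ LinearMap.ker f from h hx
    refine (fixedIdeal_mul_le_span_bracket h𝔤 hfree hJinv hJinv).trans ?_
    refine Submodule.span_le.2 ?_
    rintro _ ⟨r, hr, s, hs, rfl⟩
    exact LinearMap.mem_ker.2 (LieSupermodule.cocycle_bracket_eq_zero hf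
      (isGraded_fixedIdeal _) (hNV _ le_rfl) (hNV' _ le_rfl) hr hs)
  have hN : fixedIdeal Γ 𝔤 (I * I') ≤ LinearMap.ker f := by
    -- Each summand lacks one factor of (II')²: the first is completed by bracketing with (𝔤 ⊗
    -- I')^Γ, the second with (𝔤 ⊗ I)^Γ.
    have h : I * I' = (I * I') * I ⊔ (I * I') * I' := by rw [← Ideal.mul_sup, htop, Ideal.mul_top]
    rw [h]
    refine (fixedIdeal_sup_le (smul_mem_mul hJinv hIinv) (smul_mem_mul hJinv hI'inv)).trans
      (sup_le ?_ ?_)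
    · intro n hn
      refine LinearMap.mem_ker.2 (LieSupermodule.cocycle_eq_zero_of_span_eq_top hf
        (isGraded_fixedIdeal _) (isGraded_fixedIdeal _)
        (hNV _ Ideal.mul_le_left) (hNV' _ Ideal.mul_le_left) hKV' hspan ?_ hn)
      intro x hx n hn
      have := bracket_mem_fixedIdeal hx hn
      rw [show I' * (I * I' * I) = I * I' * (I * I') by ring] at this
      exact hsq _ this
    · intro n hn
      refine LinearMap.mem_ker.2 (LieSupermodule.cocycle_eq_zero_of_invariants_eq_zero hf
        (isGraded_fixedIdeal _) (isGraded_fixedIdeal _)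
        (hNV _ Ideal.mul_le_left) (hNV' _ Ideal.mul_le_left) hKV hinv ?_ hn)
      intro x hx n hn
      have := bracket_mem_fixedIdeal hx hn
      rw [show I * (I * I' * I') = I * I' * (I * I') by ring] at this
      exact hsq _ this
  exact LieSupermodule.mem_coboundaries₁_of_bracket_eq_zero hf
    (isGraded_fixedIdeal _) (isGraded_fixedIdeal _) hsup hKV hKV'
    hspan hinv fun x hx y hy => hN (bracket_mem_fixedIdeal hx hy)

end EquivariantMap

theorem mainTheorem7
    {𝔤 : Type*} [AddCommGroup 𝔤] [Module ℂ 𝔤] [LieSuperalgebra 𝔤] [FiniteDimensional ℂ 𝔤]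
    (h𝔤 : LieSuperalgebra.IsSimple 𝔤)
    {A : Type*} [CommRing A] [Algebra ℂ A] [Algebra.FiniteType ℂ A]
    {Γ : Type*} [CommGroup Γ] [Finite Γ]
    [DistribMulAction Γ 𝔤] [LieSuperalgebra.ActsByAut Γ 𝔤]
    [MulSemiringAction Γ A] [SMulCommClass Γ ℂ A]
    (hfree : ∀ γ : Γ, γ ≠ 1 → ∀ 𝔪 : Ideal A, 𝔪.IsMaximal → γ • 𝔪 ≠ 𝔪)
    {V : Type*} [AddCommGroup V] [Module ℂ V] [SuperSpace V]
    [LieSupermodule (EquivariantMap Γ 𝔤 A) V] [FiniteDimensional ℂ V]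
    {V' : Type*} [AddCommGroup V'] [Module ℂ V'] [SuperSpace V']
    [LieSupermodule (EquivariantMap Γ 𝔤 A) V'] [FiniteDimensional ℂ V']
    (hV : LieSupermodule.IsIrreducible (EquivariantMap Γ 𝔤 A) V)
    (hV' : LieSupermodule.IsIrreducible (EquivariantMap Γ 𝔤 A) V')
    (hVnt : ¬ LieSupermodule.IsTrivial (EquivariantMap Γ 𝔤 A) V)
    (hVnt' : ¬ LieSupermodule.IsTrivial (EquivariantMap Γ 𝔤 A) V')
    (hdisj : Disjoint (EquivariantMap.support Γ 𝔤 A V) (EquivariantMap.support Γ 𝔤 A V')) :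
    Subsingleton (LieSupermodule.Ext₁ (EquivariantMap Γ 𝔤 A) V V') := by
  refine Submodule.Quotient.subsingleton_iff.2 (Submodule.comap_subtype_eq_top.2 ?_)
  exact fun f hf => EquivariantMap.mem_coboundaries₁_of_sup_eq_top h𝔤 hfree hV hV' hVnt hVnt'
    (EquivariantMap.smul_mem_annihilator Γ 𝔤 A V) (EquivariantMap.smul_mem_annihilator Γ 𝔤 A V')
    (EquivariantMap.act_eq_zero_of_mem_fixedIdeal_annihilator Γ 𝔤 A V)
    (EquivariantMap.act_eq_zero_of_mem_fixedIdeal_annihilator Γ 𝔤 A V')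
    (EquivariantMap.annihilator_sup_annihilator_eq_top Γ 𝔤 A V V' hdisj) hf
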